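/- Let $I\subseteq\mathbb R$ be an open interval and $\varphi:I\to\mathbb R$ a real-analytic function with $\varphi'(z)\neq 0$ for all $z\in I$ and $\varphi''\not\equiv 0$. Consider the lattice equation $$u_{1,1}=f_{0,0}=u_{1,0}+u_{0,1}+\varphi(u_{0,0})\qquad(*)$$ together with all its shifts $u_{i+1,j+1}=u_{i+1,j}+u_{i,j+1}+\varphi(u_{i,j})$. Let $T_1,T_2$ be the shifts $T_1u_{i,j}=u_{i+1,j}$, $T_2u_{i,j}=u_{i,j+1}$, write $\log x$ for $\log|x|$, and let subscripts denote partial derivatives, e.g. $f_{u_{1,0}}=\partial f_{0,0}/\partial u_{1,0}$. All unknown functions $Q,P,G,\Phi,\Psi$ below are real-analytic on some connected nonempty open set. A relation between such functions is said to hold by virtue of $(*)$ if it holds for all real values $u_{i,j}$ of the variables involved at which all its terms are defined and which satisfy $(*)$ at those lattice points where it is used to express these variables through the independent ones $u_{i,0},u_{0,j}$; it is also required that such values exist. A conservation law of $(*)$ is a relation $(T_1-1)p=(T_2-1)q$ that holds by virtue of $(*)$; it is called nontrivial if its two sides do not vanish identically by virtue of $(*)$, and if it is not an identity that holds without using $(*)$.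 The integrability conditions for 5-point symmetries are: there are functions $q^{(m)}=Q^{(m)}(u_{2,0},u_{1,0},u_{0,0})$, $m=1,2$, and $p^{(m)}=P^{(m)}(u_{0,2},u_{0,1},u_{0,0})$, $m=3,4$, such that $(T_1-1)p^{(m)}=(T_2-1)q^{(m)}$, $m=1,2,3,4$, are conservation laws of $(*)$, where $$p^{(1)}=\log f_{u_{1,0}},\quad p^{(2)}=\log\frac{f_{u_{0,0}}}{f_{u_{0,1}}},\quad q^{(3)}=\log f_{u_{0,1}},\quad q^{(4)}=\log\frac{f_{u_{0,0}}}{f_{u_{1,0}}}.$$ A generalized symmetry of $(*)$ is an evolution equation $\frac{d}{dt}u_{0,0}=g_{0,0}$ such that, with $g_{i,j}=T_1^iT_2^jg_{0,0}$, $$g_{1,1}=g_{1,0}f_{u_{1,0}}+g_{0,0}f_{u_{0,0}}+g_{0,1}f_{u_{0,1}}$$ holds by virtue of $(*)$. (1) The integrability conditions are satisfied if and only if there are constants $\alpha\neq0$ and $\gamma$ such that $$\log\varphi'(z)=\alpha(\varphi(z)+z)+\gamma\quad\text{for all } z\in I.\qquad(**)$$ (2) If $(**)$ holds for some such constants, then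 the functions $Q^{(1)},Q^{(2)},P^{(3)},P^{(4)}$ can even be chosen analytic on all of $\mathbb R^3$, and $(*)$ has the two nontrivial conservation laws $$(T_1-1)(\varphi(u_{0,0})+u_{0,0})=(T_2-1)(u_{2,0}-2u_{1,0}+u_{0,0}),$$ $$(T_2-1)(\varphi(u_{0,0})+u_{0,0})=(T_1-1)(u_{0,2}-2u_{0,1}+u_{0,0}).$$ (3) If $(**)$ holds for some such constants, then $(*)$ nevertheless has no generalized symmetry of any of the following forms: $g_{0,0}=G(u_{1,0},u_{-1,0},u_{0,0},u_{0,1},u_{0,-1})$ with $G_{u_{1,0}}G_{u_{-1,0}}G_{u_{0,1}}G_{u_{0,-1}}\not\equiv0$; $g_{0,0}=\Phi(u_{1,0},u_{0,0},u_{-1,0})$ with $\Phi_{u_{1,0}}\Phi_{u_{-1,0}}\not\equiv0$; $g_{0,0}=\Psi(u_{0,1},u_{0,0},u_{0,-1})$ with $\Psi_{u_{0,1}}\Psi_{u_{0,-1}}\not\equiv0$. -/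

import Mathlib

open Set

namespace QuadEq

/-- A function `(i, j) ↦ u i j` on the square lattice. -/
abbrev Lattice : Type := ℤ → ℤ → ℝ

/-- The shift `T₁ ^ a T₂ ^ b`. -/
def shift (a b : ℤ) (u : Lattice) : Lattice := fun i j => u (i + a) (j + b)

/-- An autonomous function of the lattice variables at the base point `(0, 0)`, possibly defined
only for some values of these variables. -/
structure LocalFn where
  /-- the lattice functions at which it is defined -/
  dom : Set Lattice
  /-- its value -/
  val : Lattice → ℝ

/-- Partial derivative in the `k`-th argument. -/
noncomputable def pd {n : ℕ} (k : Fin n) (f : (Fin n → ℝ) → ℝ) (x : Fin n → ℝ) : ℝ :=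
  fderiv ℝ f x (Pi.single k 1)

/-- The argument triple `(u₁₀, u₀₀, u₀₁)` of the right hand side of the equation. -/
def corner (u : Lattice) : Fin 3 → ℝ := ![u 1 0, u 0 0, u 0 1]

/-- The equation `u₁₁ = F (u₁₀, u₀₀, u₀₁)`, where `F` is defined on `D`, holds at every lattice
point `(i, j)` of the set `W`, i.e.
`u (i+1) (j+1) = F (u (i+1) j, u i j, u i (j+1))` there. -/
def SolvesOn (F : (Fin 3 → ℝ) → ℝ) (D : Set (Fin 3 → ℝ)) (W : Set (ℤ × ℤ)) (u : Lattice) : Prop :=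
  ∀ w ∈ W, corner (shift w.1 w.2 u) ∈ D ∧
    shift w.1 w.2 u 1 1 = F (corner (shift w.1 w.2 u))

/-! ### Conservation laws -/

/-- All four terms of `(T₁ - 1) p = (T₂ - 1) q` are defined at `u`. -/
def LawDefined (p q : LocalFn) (u : Lattice) : Prop :=
  u ∈ p.dom ∧ shift 1 0 u ∈ p.dom ∧ u ∈ q.dom ∧ shift 0 1 u ∈ q.dom

/-- `(T₁ - 1) p = (T₂ - 1) q` holds by virtue of the equation (`W` is the set of lattice points at
which the equation is needed to express the variables in `p`, `q` and their shifts through the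
independent ones), and it does not hold for lack of values at which it is defined. -/
def IsConservationLaw (F : (Fin 3 → ℝ) → ℝ) (D : Set (Fin 3 → ℝ)) (W : Set (ℤ × ℤ))
    (p q : LocalFn) : Prop :=
  (∃ u, SolvesOn F D W u ∧ LawDefined p q u) ∧
  ∀ u, SolvesOn F D W u → LawDefined p q u →
    p.val (shift 1 0 u) - p.val u = q.val (shift 0 1 u) - q.val u

/-- A conservation law is nontrivial if its two sides do not vanish identically by virtue of the
equation, and if it is not an identity that holds without the equation. -/
def IsNontrivialConservationLaw (F : (Fin 3 → ℝ) → ℝ) (D : Set (Fin 3 → ℝ)) (W : Set (ℤ × ℤ))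
    (p q : LocalFn) : Prop :=
  IsConservationLaw F D W p q ∧
  (∃ u, SolvesOn F D W u ∧ LawDefined p q u ∧ p.val (shift 1 0 u) - p.val u ≠ 0) ∧
  (∃ u, LawDefined p q u ∧
    p.val (shift 1 0 u) - p.val u ≠ q.val (shift 0 1 u) - q.val u)

/-- The function `Q (u₂₀, u₁₀, u₀₀)`, with `Q` defined on `Ω`. -/
def row (Ω : Set (Fin 3 → ℝ)) (Q : (Fin 3 → ℝ) → ℝ) : LocalFn where
  dom := {u | ![u 2 0, u 1 0, u 0 0] ∈ Ω}
  val := fun u => Q ![u 2 0, u 1 0, u 0 0]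

/-- The function `P (u₀₂, u₀₁, u₀₀)`, with `P` defined on `Ω`. -/
def col (Ω : Set (Fin 3 → ℝ)) (P : (Fin 3 → ℝ) → ℝ) : LocalFn where
  dom := {u | ![u 0 2, u 0 1, u 0 0] ∈ Ω}
  val := fun u => P ![u 0 2, u 0 1, u 0 0]

/-- `A (u₁₀, u₀₀, u₀₁)`, with `A` defined on `D`. -/
def ofCorner (D : Set (Fin 3 → ℝ)) (A : (Fin 3 → ℝ) → ℝ) : LocalFn where
  dom := {u | corner u ∈ D}
  val := fun u => A (corner u)

/-- `log f_{u₁₀}`; recall that `Real.log x = log |x|`. -/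
noncomputable def p₁ (F : (Fin 3 → ℝ) → ℝ) (x : Fin 3 → ℝ) : ℝ := Real.log (pd 0 F x)

/-- `log (f_{u₀₀} / f_{u₀₁})`. -/
noncomputable def p₂ (F : (Fin 3 → ℝ) → ℝ) (x : Fin 3 → ℝ) : ℝ := Real.log (pd 1 F x / pd 2 F x)

/-- `log f_{u₀₁}`. -/
noncomputable def q₃ (F : (Fin 3 → ℝ) → ℝ) (x : Fin 3 → ℝ) : ℝ := Real.log (pd 2 F x)

/-- `log (f_{u₀₀} / f_{u₁₀})`. -/
noncomputable def q₄ (F : (Fin 3 → ℝ) → ℝ) (x : Fin 3 → ℝ) : ℝ := Real.log (pd 1 F x / pd 0 F x)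

/-- Lattice points at which the equation enters a law built from `u₂₀, u₁₀, u₀₀`. -/
def rowQuads : Set (ℤ × ℤ) := {(0, 0), (1, 0)}

/-- Lattice points at which the equation enters a law built from `u₀₂, u₀₁, u₀₀`. -/
def colQuads : Set (ℤ × ℤ) := {(0, 0), (0, 1)}

/-- The four integrability conditions for 5-point symmetries, with unknown analytic functions
`Q₁ (u₂₀, u₁₀, u₀₀)`, `Q₂ (u₂₀, u₁₀, u₀₀)`, `P₃ (u₀₂, u₀₁, u₀₀)`, `P₄ (u₀₂, u₀₁, u₀₀)` on the given
domains `Ω 0, …, Ω 3`. -/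
def IntegrabilityConditionsOn (F : (Fin 3 → ℝ) → ℝ) (D : Set (Fin 3 → ℝ))
    (Ω : Fin 4 → Set (Fin 3 → ℝ)) : Prop :=
  (∃ Q, AnalyticOnNhd ℝ Q (Ω 0) ∧
    IsConservationLaw F D rowQuads (ofCorner D (p₁ F)) (row (Ω 0) Q)) ∧
  (∃ Q, AnalyticOnNhd ℝ Q (Ω 1) ∧
    IsConservationLaw F D rowQuads (ofCorner D (p₂ F)) (row (Ω 1) Q)) ∧
  (∃ P, AnalyticOnNhd ℝ P (Ω 2) ∧
    IsConservationLaw F D colQuads (col (Ω 2) P) (ofCorner D (q₃ F))) ∧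
  (∃ P, AnalyticOnNhd ℝ P (Ω 3) ∧
    IsConservationLaw F D colQuads (col (Ω 3) P) (ofCorner D (q₄ F)))

/-- The integrability conditions hold with unknown functions on some domains. -/
def IntegrabilityConditions (F : (Fin 3 → ℝ) → ℝ) (D : Set (Fin 3 → ℝ)) : Prop :=
  ∃ Ω : Fin 4 → Set (Fin 3 → ℝ), (∀ m, IsOpen (Ω m) ∧ IsConnected (Ω m)) ∧
    IntegrabilityConditionsOn F D Ω

/-! ### Generalized symmetries -/

/-- All terms of the compatibility condition for `du₀₀/dt = g` are defined at `u`. -/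
def SymmetryDefined (g : LocalFn) (u : Lattice) : Prop :=
  u ∈ g.dom ∧ shift 1 0 u ∈ g.dom ∧ shift 0 1 u ∈ g.dom ∧ shift 1 1 u ∈ g.dom

/-- `du₀₀/dt = g` is compatible with the equation:
`g₁₁ = g₁₀ f_{u₁₀} + g₀₀ f_{u₀₀} + g₀₁ f_{u₀₁}` by virtue of the equation (`W` is the set of lattice
points at which the equation is needed to express all variables through the independent ones), and
it does not hold for lack of values at which it is defined. -/
def IsGeneralizedSymmetry (F : (Fin 3 → ℝ) → ℝ) (D : Set (Fin 3 → ℝ)) (W : Set (ℤ × ℤ))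
    (g : LocalFn) : Prop :=
  (∃ u, SolvesOn F D W u ∧ SymmetryDefined g u) ∧
  ∀ u, SolvesOn F D W u → SymmetryDefined g u →
    g.val (shift 1 1 u) =
      g.val (shift 1 0 u) * pd 0 F (corner u) + g.val u * pd 1 F (corner u) +
        g.val (shift 0 1 u) * pd 2 F (corner u)

/-- `G (u₁₀, u₋₁₀, u₀₀, u₀₁, u₀₋₁)`, with `G` defined on `Ω`. -/
def cross (Ω : Set (Fin 5 → ℝ)) (G : (Fin 5 → ℝ) → ℝ) : LocalFn where
  dom := {u | ![u 1 0, u (-1) 0, u 0 0, u 0 1, u 0 (-1)] ∈ Ω}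
  val := fun u => G ![u 1 0, u (-1) 0, u 0 0, u 0 1, u 0 (-1)]

/-- `Φ (u₁₀, u₀₀, u₋₁₀)`, with `Φ` defined on `Ω`. -/
def horiz (Ω : Set (Fin 3 → ℝ)) (Φ : (Fin 3 → ℝ) → ℝ) : LocalFn where
  dom := {u | ![u 1 0, u 0 0, u (-1) 0] ∈ Ω}
  val := fun u => Φ ![u 1 0, u 0 0, u (-1) 0]

/-- `Ψ (u₀₁, u₀₀, u₀₋₁)`, with `Ψ` defined on `Ω`. -/
def vert (Ω : Set (Fin 3 → ℝ)) (Ψ : (Fin 3 → ℝ) → ℝ) : LocalFn where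
  dom := {u | ![u 0 1, u 0 0, u 0 (-1)] ∈ Ω}
  val := fun u => Ψ ![u 0 1, u 0 0, u 0 (-1)]

/-- There is a generalized symmetry `du₀₀/dt = G (u₁₀, u₋₁₀, u₀₀, u₀₁, u₀₋₁)` with
`G_{u₁₀} G_{u₋₁₀} G_{u₀₁} G_{u₀₋₁} ≢ 0`, where `G` is analytic on some domain. -/
def HasFivePointSymmetry (F : (Fin 3 → ℝ) → ℝ) (D : Set (Fin 3 → ℝ)) : Prop :=
  ∃ (Ω : Set (Fin 5 → ℝ)) (G : (Fin 5 → ℝ) → ℝ),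
    IsOpen Ω ∧ IsConnected Ω ∧ AnalyticOnNhd ℝ G Ω ∧
    (∃ x ∈ Ω, pd 0 G x * pd 1 G x * pd 3 G x * pd 4 G x ≠ 0) ∧
    IsGeneralizedSymmetry F D {(0, 0), (1, 0), (-1, 0), (0, 1), (0, -1)} (cross Ω G)

/-- There is a generalized symmetry `du₀₀/dt = Φ (u₁₀, u₀₀, u₋₁₀)` with `Φ_{u₁₀} Φ_{u₋₁₀} ≢ 0`,
where `Φ` is analytic on some domain. -/
def HasHorizontalSymmetry (F : (Fin 3 → ℝ) → ℝ) (D : Set (Fin 3 → ℝ)) : Prop :=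
  ∃ (Ω : Set (Fin 3 → ℝ)) (Φ : (Fin 3 → ℝ) → ℝ),
    IsOpen Ω ∧ IsConnected Ω ∧ AnalyticOnNhd ℝ Φ Ω ∧
    (∃ x ∈ Ω, pd 0 Φ x * pd 2 Φ x ≠ 0) ∧
    IsGeneralizedSymmetry F D {(0, 0), (1, 0), (-1, 0)} (horiz Ω Φ)

/-- There is a generalized symmetry `du₀₀/dt = Ψ (u₀₁, u₀₀, u₀₋₁)` with `Ψ_{u₀₁} Ψ_{u₀₋₁} ≢ 0`,
where `Ψ` is analytic on some domain. -/
def HasVerticalSymmetry (F : (Fin 3 → ℝ) → ℝ) (D : Set (Fin 3 → ℝ)) : Prop :=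
  ∃ (Ω : Set (Fin 3 → ℝ)) (Ψ : (Fin 3 → ℝ) → ℝ),
    IsOpen Ω ∧ IsConnected Ω ∧ AnalyticOnNhd ℝ Ψ Ω ∧
    (∃ x ∈ Ω, pd 0 Ψ x * pd 2 Ψ x ≠ 0) ∧
    IsGeneralizedSymmetry F D {(0, 0), (0, 1), (0, -1)} (vert Ω Ψ)

/-! ### The equation `u₁₁ = u₁₀ + u₀₁ + φ (u₀₀)` -/

/-- The right hand side `u₁₀ + u₀₁ + φ (u₀₀)`, as a function of `(u₁₀, u₀₀, u₀₁)`. -/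
def rhs (φ : ℝ → ℝ) (x : Fin 3 → ℝ) : ℝ := x 0 + x 2 + φ (x 1)

/-- Its domain, when `φ` is defined on `I`. -/
def rhsDom (I : Set ℝ) : Set (Fin 3 → ℝ) := {x | x 1 ∈ I}

/-- `log φ' (z) = α (φ (z) + z) + γ` on `I`, for some constants `α ≠ 0` and `γ`. -/
def LogDerivEq (φ : ℝ → ℝ) (I : Set ℝ) : Prop :=
  ∃ α γ : ℝ, α ≠ 0 ∧ ∀ z ∈ I, Real.log (deriv φ z) = α * (φ z + z) + γ

/-- The function `φ (u₀₀) + u₀₀`. -/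
def density (φ : ℝ → ℝ) (I : Set ℝ) : LocalFn where
  dom := {u | u 0 0 ∈ I}
  val := fun u => φ (u 0 0) + u 0 0

/-- The second difference `x₀ - 2 x₁ + x₂`. -/
def secondDiff (x : Fin 3 → ℝ) : ℝ := x 0 - 2 * x 1 + x 2

end QuadEq

/-! Since f_{u₁₀} = f_{u₀₁} = 1 and f_{u₀₀} = φ', the conditions m = 1, 3 are met by zero functions,
while m = 2 and m = 4 are exchanged by swapping the two lattice directions. Let Q satisfy m = 2.
Varying u₀₁ moves u₂₁, u₁₁, u₀₁ equally, so Q depends locally only on the differences of its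
consecutive arguments. With (x, y, z) = (u₀₀, u₁₀, u₂₀) and L = log φ' this becomes B(z + φ(y), y +
φ(x)) - A(z - y, y - x) = L(y) - L(x), where A and B are germs of Q at two points.

`Admissible.functional_equation` solves this. Its z-derivative B₁ = A₁ is the same equation with
right-hand side zero. There, eliminating B leaves a relation in which A is unaffected by a common
translation of x, y, z. Differentiating along the translation, continuing analytically to I × I and
setting x = y would give (1 + φ')² φ'' = 0 unless the first derivatives of the solution vanish.
Hence A₁ is a constant a. The same device then yields L' = a(1 + φ') + m, A₂ = -(a + m) and B₂ = -a.
When A and B are germs of one analytic function on a connected domain, comparing A₂ with B₂ gives m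
= 0, and integration gives (**); see `Admissible.deriv_eq_of_row_law`. Conversely, the laws with
density φ(u) + u hold for every admissible φ, and under (**) log φ' is an affine function of that
density, so α times the second difference is a suitable Q.

The absence of symmetries rests on `Admissible.false_of_relations`. Differentiating the
compatibility condition in u₂₀ gives the homogeneous functional equation for G_{u₁₀}, which is
therefore constant. Differentiating in u₋₁₀ gives a multiplicative relation for K = G_{u₋₁₀}.
Wherever K ≠ 0 its logarithm is the functional equation with L = α(φ + z), so log |K| has
u₁₀-derivative α ≠ 0. But K_{u₁₀} is a derivative of the constant G_{u₁₀}, hence zero, and so K ≡ 0.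
-/

namespace QuadEq

open Filter Topology

/-! ### Analytic preliminaries -/

section Preliminaries

variable {V : Type*} [NormedAddCommGroup V] [NormedSpace ℝ V]

/-- The directional derivative of `f` along `v`. -/
noncomputable def dirDeriv (v : V) (f : V → ℝ) (p : V) : ℝ := fderiv ℝ f p v

theorem analyticAt_dirDeriv {f : V → ℝ} {p : V} (hf : AnalyticAt ℝ f p) (v : V) :
    AnalyticAt ℝ (dirDeriv v f) p :=
  ((ContinuousLinearMap.apply ℝ ℝ v).analyticAt _).comp hf.fderiv

theorem analyticOnNhd_dirDeriv {f : V → ℝ} {Ω : Set V} (hf : AnalyticOnNhd ℝ f Ω) (v : V) :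
    AnalyticOnNhd ℝ (dirDeriv v f) Ω := fun p hp => analyticAt_dirDeriv (hf p hp) v

theorem dirDeriv_comm {f : V → ℝ} {p : V} (hf : AnalyticAt ℝ f p) (v w : V) :
    dirDeriv v (dirDeriv w f) p = dirDeriv w (dirDeriv v f) p := by
  have hs : IsSymmSndFDerivAt ℝ f p :=
    (hf.contDiffAt (n := 2)).isSymmSndFDerivAt (by simp)
  have key : ∀ u : V, fderiv ℝ (dirDeriv u f) p =
      (ContinuousLinearMap.apply ℝ ℝ u).comp (fderiv ℝ (fderiv ℝ f) p) := fun u =>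
    ((ContinuousLinearMap.apply ℝ ℝ u).hasFDerivAt.comp p
      hf.fderiv.differentiableAt.hasFDerivAt).fderiv
  unfold dirDeriv at key ⊢
  rw [key, key]
  exact hs v w

/-- `Real.log` is log |·|, so it equals half the logarithm of the square, whose argument is
positive. No sign of φ' or of K has to be fixed. -/
theorem analyticAt_log_of_ne_zero {f : V → ℝ} {p : V} (hf : AnalyticAt ℝ f p) (h : f p ≠ 0) :
    AnalyticAt ℝ (fun q => Real.log (f q)) p := by
  have h2 : (fun q => Real.log (f q)) = fun q => (1 / 2 : ℝ) * Real.log (f q ^ 2) := by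
    funext q; rw [Real.log_pow]; push_cast; ring
  rw [h2]
  have hl : AnalyticAt ℝ Real.log (f p ^ 2) := analyticAt_log (by positivity)
  exact analyticAt_const.mul (hl.comp (f := fun q => f q ^ 2) (hf.pow 2))

theorem hasDerivAt_comp_curve {f : V → ℝ} {c : ℝ → V} {v p : V} {s : ℝ}
    (hc : HasDerivAt c v s) (hp : c s = p) (hf : AnalyticAt ℝ f p) :
    HasDerivAt (fun r => f (c r)) (dirDeriv v f p) s := by
  subst hp
  exact hf.differentiableAt.hasFDerivAt.comp_hasDerivAt s hc

/-- An identity that holds near a point can be differentiated along curves near that point. -/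
theorem eventually_deriv_eq {W : Type*} [TopologicalSpace W] {w₀ : W} {F G : W → ℝ}
    (h : ∀ᶠ w in 𝓝 w₀, F w = G w) :
    ∀ᶠ w in 𝓝 w₀, ∀ (γ : ℝ → W) (s a b : ℝ), γ s = w → ContinuousAt γ s →
      HasDerivAt (fun r => F (γ r)) a s → HasDerivAt (fun r => G (γ r)) b s → a = b := by
  filter_upwards [h.eventually_nhds] with w hw γ s a b hs hγ ha hb
  subst hs
  have : (fun r => F (γ r)) =ᶠ[𝓝 s] fun r => G (γ r) := hγ.eventually hw
  exact (ha.congr_of_eventuallyEq this.symm).unique hb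

theorem eventually_eq_const_of_dirDeriv_eq_zero {f : V → ℝ} {p : V} (hf : AnalyticAt ℝ f p)
    (h : ∀ᶠ q in 𝓝 p, ∀ v, dirDeriv v f q = 0) : ∀ᶠ q in 𝓝 p, f q = f p := by
  obtain ⟨ε, hε, hb⟩ := Metric.eventually_nhds_iff_ball.1 (h.and hf.eventually_analyticAt)
  filter_upwards [Metric.ball_mem_nhds p hε] with q hq
  exact Metric.isOpen_ball.is_const_of_fderiv_eq_zero (𝕜 := ℝ) (convex_ball p ε).isPreconnected
    (fun r hr => (hb r hr).2.differentiableAt.differentiableWithinAt)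
    (fun r hr => ContinuousLinearMap.ext fun v => (hb r hr).1 v) hq (Metric.mem_ball_self hε)

theorem eq_zero_on_of_eventually {f : V → ℝ} {Ω : Set V} (hf : AnalyticOnNhd ℝ f Ω)
    (hΩ : IsPreconnected Ω) {p : V} (hp : p ∈ Ω) (h : ∀ᶠ q in 𝓝 p, f q = 0) :
    ∀ q ∈ Ω, f q = 0 :=
  hf.eqOn_zero_of_preconnected_of_eventuallyEq_zero hΩ hp h

/-- A relation between separately analytic functions of two variables on `I × I` extends from a
neighbourhood of a point. -/
theorem eq_zero_of_eventually_prod {I : Set ℝ} (hIc : IsPreconnected I) {T : ℝ → ℝ → ℝ}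
    (h₁ : ∀ y ∈ I, AnalyticOnNhd ℝ (fun x => T x y) I)
    (h₂ : ∀ x ∈ I, AnalyticOnNhd ℝ (fun y => T x y) I) {x₀ y₀ : ℝ} (hI : IsOpen I)
    (hx : x₀ ∈ I) (hy : y₀ ∈ I) (h : ∀ᶠ x in 𝓝 x₀, ∀ᶠ y in 𝓝 y₀, T x y = 0) :
    ∀ x ∈ I, ∀ y ∈ I, T x y = 0 := by
  intro x hxI y hyI
  refine eq_zero_on_of_eventually (h₁ y hyI) hIc hx ?_ x hxI
  filter_upwards [h, hI.mem_nhds hx] with x' hx' hx'I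
  exact eq_zero_on_of_eventually (h₂ x' hx'I) hIc hy hx' y hyI

theorem eq_add_const_of_deriv_eq {I : Set ℝ} (hI : IsOpen I) (hIc : IsPreconnected I)
    {f g : ℝ → ℝ} (hf : AnalyticOnNhd ℝ f I) (hg : AnalyticOnNhd ℝ g I)
    (h : ∀ x ∈ I, deriv f x = deriv g x) : ∃ c, ∀ x ∈ I, f x = g x + c :=
  hI.exists_eq_add_of_deriv_eq hIc (fun x hx => (hf x hx).differentiableAt.differentiableWithinAt)
    (fun x hx => (hg x hx).differentiableAt.differentiableWithinAt) h

/-- A local right inverse of a function of one variable. -/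
theorem exists_local_right_inverse {φ : ℝ → ℝ} {x : ℝ} (hφ : AnalyticAt ℝ φ x)
    (h : deriv φ x ≠ 0) : ∃ ψ : ℝ → ℝ, ContinuousAt ψ (φ x) ∧ ψ (φ x) = x ∧
      ∀ᶠ s in 𝓝 (φ x), φ (ψ s) = s := by
  have hs := hφ.hasStrictDerivAt
  refine ⟨hs.localInverse φ _ x h, (hs.to_localInverse h).hasDerivAt.continuousAt, ?_,
    hs.eventually_right_inverse h⟩
  exact (hs.eventually_left_inverse h).self_of_nhds

end Preliminaries

/-- The standing assumptions on `φ`. -/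
structure Admissible (φ : ℝ → ℝ) (I : Set ℝ) : Prop where
  isOpen : IsOpen I
  conn : IsPreconnected I
  analytic : AnalyticOnNhd ℝ φ I
  deriv_ne : ∀ z ∈ I, deriv φ z ≠ 0
  deriv2 : ∃ z ∈ I, deriv (deriv φ) z ≠ 0

/-! ### Consequences of φ'' ≢ 0 -/

namespace Admissible

variable {φ : ℝ → ℝ} {I : Set ℝ}

theorem analytic_deriv (H : Admissible φ I) : AnalyticOnNhd ℝ (deriv φ) I := H.analytic.deriv

theorem analytic_deriv2 (H : Admissible φ I) : AnalyticOnNhd ℝ (deriv (deriv φ)) I := H.analytic.deriv.deriv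

theorem deriv_not_const (H : Admissible φ I) (c : ℝ) : ¬ ∀ z ∈ I, deriv φ z = c := by
  intro h
  obtain ⟨z, hz, hne⟩ := H.deriv2
  apply hne
  have : deriv φ =ᶠ[𝓝 z] fun _ => c := by
    filter_upwards [H.isOpen.mem_nhds hz] with w hw using h w hw
  simpa using this.deriv_eq

/-- Analytic functions on a connected set form an integral domain, and 1 + φ' is not its zero
element, since φ' is not constant. This is how factors 1 + φ' are cancelled. -/
theorem eq_zero_of_one_add_mul (H : Admissible φ I) {k : ℝ → ℝ} (hk : AnalyticOnNhd ℝ k I)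
    (h : ∀ z ∈ I, (1 + deriv φ z) * k z = 0) : ∀ z ∈ I, k z = 0 := by
  refine ((analyticOnNhd_const.add H.analytic_deriv).eq_zero_or_eq_zero_of_mul_eq_zero hk h
    H.conn).resolve_left fun h' => H.deriv_not_const (-1) fun z hz => ?_
  have := h' z hz
  simp only [Pi.add_apply] at this
  linarith

/-- By the identity theorem, local constancy of φ' would spread to all of I. -/
theorem not_eventually_deriv_eq (H : Admissible φ I) {x : ℝ} (hx : x ∈ I) (c : ℝ) :
    ¬ ∀ᶠ z in 𝓝 x, deriv φ z = c := by
  intro h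
  refine H.deriv_not_const c fun z hz => ?_
  have := eq_zero_on_of_eventually (H.analytic_deriv.sub (analyticOnNhd_const (v := c))) H.conn hx
    (h.mono fun z hz => by simp [hz]) z hz
  simp only [Pi.sub_apply] at this
  linarith

end Admissible

/-! ### The functional equation for germs -/

/-- The chain rule in z, y and x, in this order. The result is stated on a neighbourhood, not only
at the point, because it is differentiated again later. -/
theorem eventually_deriv_relation {φ M N : ℝ → ℝ} {A B : ℝ × ℝ → ℝ} {x₀ y₀ z₀ : ℝ}
    (hφx : AnalyticAt ℝ φ x₀) (hφy : AnalyticAt ℝ φ y₀) (hM : AnalyticAt ℝ M y₀)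
    (hN : AnalyticAt ℝ N x₀) (hA : AnalyticAt ℝ A (z₀ - y₀, y₀ - x₀))
    (hB : AnalyticAt ℝ B (z₀ + φ y₀, y₀ + φ x₀))
    (h : ∀ᶠ w : ℝ × ℝ × ℝ in 𝓝 (x₀, y₀, z₀),
      B (w.2.2 + φ w.2.1, w.2.1 + φ w.1) - A (w.2.2 - w.2.1, w.2.1 - w.1) = M w.2.1 - N w.1) :
    ∀ᶠ w : ℝ × ℝ × ℝ in 𝓝 (x₀, y₀, z₀),
      dirDeriv (1, 0) B (w.2.2 + φ w.2.1, w.2.1 + φ w.1) =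
        dirDeriv (1, 0) A (w.2.2 - w.2.1, w.2.1 - w.1) ∧
      dirDeriv (1, 0) B (w.2.2 + φ w.2.1, w.2.1 + φ w.1) * deriv φ w.2.1 +
        dirDeriv (0, 1) B (w.2.2 + φ w.2.1, w.2.1 + φ w.1) +
        dirDeriv (1, 0) A (w.2.2 - w.2.1, w.2.1 - w.1) -
        dirDeriv (0, 1) A (w.2.2 - w.2.1, w.2.1 - w.1) = deriv M w.2.1 ∧
      dirDeriv (0, 1) B (w.2.2 + φ w.2.1, w.2.1 + φ w.1) * deriv φ w.1 +
        dirDeriv (0, 1) A (w.2.2 - w.2.1, w.2.1 - w.1) = - deriv N w.1 := by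
  have cx : ContinuousAt (fun w : ℝ × ℝ × ℝ => w.1) (x₀, y₀, z₀) := by fun_prop
  have cy : ContinuousAt (fun w : ℝ × ℝ × ℝ => w.2.1) (x₀, y₀, z₀) := by fun_prop
  have cA : ContinuousAt (fun w : ℝ × ℝ × ℝ => (w.2.2 - w.2.1, w.2.1 - w.1)) (x₀, y₀, z₀) := by
    fun_prop
  have cφx : ContinuousAt (fun w : ℝ × ℝ × ℝ => φ w.1) (x₀, y₀, z₀) :=
    ContinuousAt.comp (f := fun w : ℝ × ℝ × ℝ => w.1) hφx.continuousAt cx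
  have cφy : ContinuousAt (fun w : ℝ × ℝ × ℝ => φ w.2.1) (x₀, y₀, z₀) :=
    ContinuousAt.comp (f := fun w : ℝ × ℝ × ℝ => w.2.1) hφy.continuousAt cy
  have cB : ContinuousAt (fun w : ℝ × ℝ × ℝ => (w.2.2 + φ w.2.1, w.2.1 + φ w.1)) (x₀, y₀, z₀) := by
    fun_prop
  filter_upwards [eventually_deriv_eq h, cx.eventually hφx.eventually_analyticAt,
    cy.eventually hφy.eventually_analyticAt, cy.eventually hM.eventually_analyticAt,
    cx.eventually hN.eventually_analyticAt, cA.eventually hA.eventually_analyticAt,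
    cB.eventually hB.eventually_analyticAt] with ⟨x, y, z⟩ hd hx hy hMy hNx hAw hBw
  simp only at hd hx hy hMy hNx hAw hBw ⊢
  have dx := hx.differentiableAt.hasDerivAt
  have dy := hy.differentiableAt.hasDerivAt
  refine ⟨?_, ?_, ?_⟩
  · have e := hd (fun r => (x, y, r)) z _ _ rfl (by fun_prop)
      ((hasDerivAt_comp_curve
        (((hasDerivAt_id' z).add_const (φ y)).prodMk (hasDerivAt_const z (y + φ x))) rfl hBw).sub
      (hasDerivAt_comp_curve
        (((hasDerivAt_id' z).sub_const y).prodMk (hasDerivAt_const z (y - x))) rfl hAw))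
      (hasDerivAt_const z (M y - N x))
    linarith
  · have e := hd (fun r => (x, r, z)) y _ _ rfl (by fun_prop)
      ((hasDerivAt_comp_curve
        ((dy.const_add z).prodMk ((hasDerivAt_id' y).add_const (φ x))) rfl hBw).sub
      (hasDerivAt_comp_curve
        (((hasDerivAt_id' y).const_sub z).prodMk ((hasDerivAt_id' y).sub_const x)) rfl hAw))
      (hMy.differentiableAt.hasDerivAt.sub_const (N x))
    have e1 : dirDeriv (deriv φ y, 1) B (z + φ y, y + φ x) =
        dirDeriv (1, 0) B (z + φ y, y + φ x) * deriv φ y +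
        dirDeriv (0, 1) B (z + φ y, y + φ x) := by
      have : ((deriv φ y, 1) : ℝ × ℝ) = deriv φ y • (1, 0) + (0, 1) := by simp
      unfold dirDeriv
      rw [this, map_add, map_smul, smul_eq_mul, mul_comm]
    have e2 : dirDeriv (-1, 1) A (z - y, y - x) =
        - dirDeriv (1, 0) A (z - y, y - x) + dirDeriv (0, 1) A (z - y, y - x) := by
      have : ((-1, 1) : ℝ × ℝ) = - (1, 0) + (0, 1) := by simp
      unfold dirDeriv
      rw [this, map_add, map_neg]
    rw [e1, e2] at e
    linarith
  · have e := hd (fun r => (r, y, z)) x _ _ rfl (by fun_prop)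
      ((hasDerivAt_comp_curve
        ((hasDerivAt_const x (z + φ y)).prodMk (dx.const_add y)) rfl hBw).sub
      (hasDerivAt_comp_curve
        ((hasDerivAt_const x (z - y)).prodMk ((hasDerivAt_id' x).const_sub y)) rfl hAw))
      (hNx.differentiableAt.hasDerivAt.const_sub (M y))
    have e1 : dirDeriv (0, deriv φ x) B (z + φ y, y + φ x) =
        dirDeriv (0, 1) B (z + φ y, y + φ x) * deriv φ x := by
      have : ((0, deriv φ x) : ℝ × ℝ) = deriv φ x • (0, 1) := by simp
      unfold dirDeriv
      rw [this, map_smul, smul_eq_mul, mul_comm]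
    have e2 : dirDeriv (0, -1) A (z - y, y - x) = - dirDeriv (0, 1) A (z - y, y - x) := by
      have : ((0, -1) : ℝ × ℝ) = - (0, 1) := by simp
      unfold dirDeriv
      rw [this, map_neg]
    rw [e1, e2] at e
    linarith

variable {φ L : ℝ → ℝ} {I : Set ℝ}

/-- A germ `E (z - y, y - x)` killed by `1 + φ' x` vanishes. -/
theorem Admissible.eventually_eq_zero_of_mul (H : Admissible φ I) {E : ℝ × ℝ → ℝ} {x₀ y₀ z₀ : ℝ}
    (hx₀ : x₀ ∈ I) (hE : AnalyticAt ℝ E (z₀ - y₀, y₀ - x₀))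
    (h : ∀ᶠ w : ℝ × ℝ × ℝ in 𝓝 (x₀, y₀, z₀),
      E (w.2.2 - w.2.1, w.2.1 - w.1) * (1 + deriv φ w.1) = 0) :
    ∀ᶠ w : ℝ × ℝ × ℝ in 𝓝 (x₀, y₀, z₀), E (w.2.2 - w.2.1, w.2.1 - w.1) = 0 := by
  have cA : Continuous (fun w : ℝ × ℝ × ℝ => (w.2.2 - w.2.1, w.2.1 - w.1)) := by fun_prop
  have cx : Continuous (fun w : ℝ × ℝ × ℝ => w.1) := by fun_prop
  filter_upwards [h.eventually_nhds, cA.continuousAt.eventually hE.eventually_analyticAt,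
    cx.continuousAt.eventually (H.isOpen.mem_nhds hx₀)] with ⟨x, y, z⟩ hw hEw hx
  by_contra hne
  have h1 : ∀ᶠ w : ℝ × ℝ × ℝ in 𝓝 (x, y, z), deriv φ w.1 = -1 := by
    have h2 : ContinuousAt (fun w : ℝ × ℝ × ℝ => E (w.2.2 - w.2.1, w.2.1 - w.1)) (x, y, z) :=
      ContinuousAt.comp (f := fun w : ℝ × ℝ × ℝ => (w.2.2 - w.2.1, w.2.1 - w.1))
        hEw.continuousAt cA.continuousAt
    filter_upwards [hw, h2.eventually_ne hne] with w hw1 hw2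
    have := (mul_eq_zero.1 hw1).resolve_left hw2
    linarith
  have c3 : ContinuousAt (fun r : ℝ => (r, y, z)) x := by fun_prop
  exact H.not_eventually_deriv_eq hx (-1) (c3.eventually h1)

/-- A relation on triples near a point whose terms only involve the first two variables. -/
theorem eventually_prod_of_triple {R : ℝ → ℝ → Prop} {x₀ y₀ z₀ : ℝ}
    (h : ∀ᶠ w : ℝ × ℝ × ℝ in 𝓝 (x₀, y₀, z₀), R w.1 w.2.1) :
    ∀ᶠ x in 𝓝 x₀, ∀ᶠ y in 𝓝 y₀, R x y := by
  rw [nhds_prod_eq] at h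
  refine h.curry.mono fun x hx => ?_
  have c : ContinuousAt (fun y : ℝ => (y, z₀)) y₀ := by fun_prop
  exact c.eventually hx

/-- The mixed second derivatives of `A` vanish when the functional equation has no inhomogeneity in
its first derivative. -/
theorem Admissible.eventually_dirDeriv_eq_zero (H : Admissible φ I) {A B : ℝ × ℝ → ℝ}
    {x₀ y₀ z₀ : ℝ} (hx₀ : x₀ ∈ I) (hy₀ : y₀ ∈ I) (hA : AnalyticAt ℝ A (z₀ - y₀, y₀ - x₀))
    (hB : AnalyticAt ℝ B (z₀ + φ y₀, y₀ + φ x₀))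
    (h : ∀ᶠ w : ℝ × ℝ × ℝ in 𝓝 (x₀, y₀, z₀),
      B (w.2.2 + φ w.2.1, w.2.1 + φ w.1) = A (w.2.2 - w.2.1, w.2.1 - w.1)) :
    ∀ᶠ w : ℝ × ℝ × ℝ in 𝓝 (x₀, y₀, z₀),
      dirDeriv (1, 0) A (w.2.2 - w.2.1, w.2.1 - w.1) = 0 ∧
      dirDeriv (0, 1) A (w.2.2 - w.2.1, w.2.1 - w.1) = 0 := by
  have cA : Continuous (fun w : ℝ × ℝ × ℝ => (w.2.2 - w.2.1, w.2.1 - w.1)) := by fun_prop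
  have cx : Continuous (fun w : ℝ × ℝ × ℝ => w.1) := by fun_prop
  have cy : Continuous (fun w : ℝ × ℝ × ℝ => w.2.1) := by fun_prop
  have hI1 := cx.continuousAt.eventually (H.isOpen.mem_nhds hx₀ : I ∈ 𝓝 (x₀, y₀, z₀).1)
  have hI2 := cy.continuousAt.eventually (H.isOpen.mem_nhds hy₀ : I ∈ 𝓝 (x₀, y₀, z₀).2.1)
  have hd := eventually_deriv_relation (M := fun _ => 0) (N := fun _ => 0) (H.analytic x₀ hx₀)
    (H.analytic y₀ hy₀) analyticAt_const analyticAt_const hA hB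
    (h.mono fun w hw => by rw [hw]; ring)
  -- Both derivatives of B are eliminated from the three relations; what remains involves A and φ'
  -- only.
  have hEF : ∀ᶠ w : ℝ × ℝ × ℝ in 𝓝 (x₀, y₀, z₀),
      dirDeriv (1, 0) A (w.2.2 - w.2.1, w.2.1 - w.1) * ((1 + deriv φ w.2.1) * deriv φ w.1) =
      dirDeriv (0, 1) A (w.2.2 - w.2.1, w.2.1 - w.1) * (1 + deriv φ w.1) := by
    filter_upwards [hd] with w hw
    obtain ⟨h1, h2, h3⟩ := hw
    simp only [deriv_const', neg_zero] at h2 h3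
    rw [h1] at h2
    linear_combination deriv φ w.1 * h2 - h3
  -- Along (x + r, y + r, z + r) the arguments of A stay fixed, so only φ' is differentiated.
  -- Combining the outcome with `hEF` eliminates A₂.
  have hS : ∀ᶠ w : ℝ × ℝ × ℝ in 𝓝 (x₀, y₀, z₀),
      dirDeriv (1, 0) A (w.2.2 - w.2.1, w.2.1 - w.1) *
        (deriv (deriv φ) w.1 * (1 + deriv φ w.2.1) +
          deriv (deriv φ) w.2.1 * deriv φ w.1 * (1 + deriv φ w.1)) = 0 := by
    filter_upwards [eventually_deriv_eq hEF, hEF, hI1, hI2] with ⟨x, y, z⟩ hw hw0 hx hy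
    simp only at hw hw0 hx hy ⊢
    have dx := (H.analytic_deriv x hx).differentiableAt.hasDerivAt
    have dy := (H.analytic_deriv y hy).differentiableAt.hasDerivAt
    have dx' : HasDerivAt (fun r => deriv φ (x + r)) (deriv (deriv φ) x) 0 :=
      HasDerivAt.comp_const_add x 0 (by simpa using dx)
    have dy' : HasDerivAt (fun r => deriv φ (y + r)) (deriv (deriv φ) y) 0 :=
      HasDerivAt.comp_const_add y 0 (by simpa using dy)
    have e := hw (fun r => (x + r, y + r, z + r)) 0
      (dirDeriv (1, 0) A (z - y, y - x) *
        (deriv (deriv φ) y * deriv φ x + (1 + deriv φ y) * deriv (deriv φ) x))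
      (dirDeriv (0, 1) A (z - y, y - x) * deriv (deriv φ) x) (by simp) (by fun_prop)
      (by
        simp only [add_sub_add_right_eq_sub]
        simpa using ((dy'.const_add 1).mul dx').const_mul (dirDeriv (1, 0) A (z - y, y - x)))
      (by
        simp only [add_sub_add_right_eq_sub]
        exact (dx'.const_add 1).const_mul _)
    linear_combination (1 + deriv φ x) * e - deriv (deriv φ) x * hw0
  have hE : ∀ᶠ w : ℝ × ℝ × ℝ in 𝓝 (x₀, y₀, z₀),
      dirDeriv (1, 0) A (w.2.2 - w.2.1, w.2.1 - w.1) = 0 := by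
    filter_upwards [hS.eventually_nhds, hI1, hI2,
      cA.continuousAt.eventually hA.eventually_analyticAt] with ⟨x, y, z⟩ hw hx hy hAw
    by_contra hne
    have c2 : ContinuousAt (fun w : ℝ × ℝ × ℝ =>
        dirDeriv (1, 0) A (w.2.2 - w.2.1, w.2.1 - w.1)) (x, y, z) :=
      ContinuousAt.comp (f := fun w : ℝ × ℝ × ℝ => (w.2.2 - w.2.1, w.2.1 - w.1))
        (analyticAt_dirDeriv hAw (1, 0)).continuousAt cA.continuousAt
    have h1 : ∀ᶠ w : ℝ × ℝ × ℝ in 𝓝 (x, y, z), deriv (deriv φ) w.1 * (1 + deriv φ w.2.1) +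
          deriv (deriv φ) w.2.1 * deriv φ w.1 * (1 + deriv φ w.1) = 0 := by
      filter_upwards [hw, c2.eventually_ne hne] with w hw1 hw2
      exact (mul_eq_zero.1 hw1).resolve_left hw2
    -- The second factor is free of z and vanishes near (x, y), hence on all of I × I, in particular
    -- on the diagonal, which the original points need not approach.
    have h2 := eq_zero_of_eventually_prod H.conn (T := fun x y =>
      deriv (deriv φ) x * (1 + deriv φ y) + deriv (deriv φ) y * deriv φ x * (1 + deriv φ x))
      (fun y _ x hx => by
        have a1 := H.analytic_deriv x hx
        have a2 := H.analytic_deriv2 x hx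
        fun_prop)
      (fun x _ y hy => by
        have a1 := H.analytic_deriv y hy
        have a2 := H.analytic_deriv2 y hy
        fun_prop) H.isOpen hx hy (eventually_prod_of_triple (R := fun x y => deriv (deriv φ) x *
          (1 + deriv φ y) + deriv (deriv φ) y * deriv φ x * (1 + deriv φ x) = 0) h1)
    -- On the diagonal the factor is (1 + φ')² φ''; one power of 1 + φ' is cancelled at a time.
    have h3 : ∀ z ∈ I, deriv (deriv φ) z = 0 :=
      H.eq_zero_of_one_add_mul H.analytic_deriv2 <| H.eq_zero_of_one_add_mul
        (fun x hx => by
          have a1 := H.analytic_deriv x hx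
          have a2 := H.analytic_deriv2 x hx
          fun_prop)
        fun z hz => by linear_combination h2 z hz z hz
    obtain ⟨z, hz, hne⟩ := H.deriv2
    exact hne (h3 z hz)
  refine hE.and ?_
  refine H.eventually_eq_zero_of_mul hx₀ (analyticAt_dirDeriv hA (0, 1)) ?_
  filter_upwards [hE, hEF] with w h1 h2
  rw [← h2, h1, zero_mul]

/-- The difference map has the continuous section p ↦ (x₀, x₀ + p₂, x₀ + p₂ + p₁) through the base
point, so it covers a neighbourhood of the pair of differences. -/
theorem eventually_of_eventually_diff {R : ℝ × ℝ → Prop} {x₀ y₀ z₀ : ℝ}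
    (h : ∀ᶠ w : ℝ × ℝ × ℝ in 𝓝 (x₀, y₀, z₀), R (w.2.2 - w.2.1, w.2.1 - w.1)) :
    ∀ᶠ p in 𝓝 (z₀ - y₀, y₀ - x₀), R p := by
  have c : ContinuousAt (fun p : ℝ × ℝ => (x₀, x₀ + p.2, x₀ + p.2 + p.1)) (z₀ - y₀, y₀ - x₀) := by
    fun_prop
  have e : (fun p : ℝ × ℝ => (x₀, x₀ + p.2, x₀ + p.2 + p.1)) (z₀ - y₀, y₀ - x₀) = (x₀, y₀, z₀) := by
    simp
  rw [← e] at h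
  filter_upwards [c.eventually h] with p hp
  simpa using hp

/-- The functional equation
`L y - L x = B (z + φ y, y + φ x) - A (z - y, y - x)` determines the first derivatives of the germs
`A` and `B`, and forces `L' = a (1 + φ') + m`. -/
theorem Admissible.functional_equation (H : Admissible φ I) (hL : AnalyticOnNhd ℝ L I)
    {A B : ℝ × ℝ → ℝ} {x₀ y₀ z₀ : ℝ} (hx₀ : x₀ ∈ I) (hy₀ : y₀ ∈ I)
    (hA : AnalyticAt ℝ A (z₀ - y₀, y₀ - x₀)) (hB : AnalyticAt ℝ B (z₀ + φ y₀, y₀ + φ x₀))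
    (h : ∀ᶠ w : ℝ × ℝ × ℝ in 𝓝 (x₀, y₀, z₀),
      B (w.2.2 + φ w.2.1, w.2.1 + φ w.1) - A (w.2.2 - w.2.1, w.2.1 - w.1) = L w.2.1 - L w.1) :
    ∃ a m : ℝ, (∀ x ∈ I, deriv L x = a * (1 + deriv φ x) + m) ∧
      ∀ᶠ w : ℝ × ℝ × ℝ in 𝓝 (x₀, y₀, z₀),
        dirDeriv (1, 0) A (w.2.2 - w.2.1, w.2.1 - w.1) = a ∧
        dirDeriv (0, 1) A (w.2.2 - w.2.1, w.2.1 - w.1) = -(a + m) ∧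
        dirDeriv (1, 0) B (w.2.2 + φ w.2.1, w.2.1 + φ w.1) = a ∧
        dirDeriv (0, 1) B (w.2.2 + φ w.2.1, w.2.1 + φ w.1) = -a := by
  have cA : Continuous (fun w : ℝ × ℝ × ℝ => (w.2.2 - w.2.1, w.2.1 - w.1)) := by fun_prop
  have cx : Continuous (fun w : ℝ × ℝ × ℝ => w.1) := by fun_prop
  have cy : Continuous (fun w : ℝ × ℝ × ℝ => w.2.1) := by fun_prop
  have hI1 := cx.continuousAt.eventually (H.isOpen.mem_nhds hx₀ : I ∈ 𝓝 (x₀, y₀, z₀).1)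
  have hI2 := cy.continuousAt.eventually (H.isOpen.mem_nhds hy₀ : I ∈ 𝓝 (x₀, y₀, z₀).2.1)
  have hd := eventually_deriv_relation (H.analytic x₀ hx₀) (H.analytic y₀ hy₀) (hL y₀ hy₀)
    (hL x₀ hx₀) hA hB h
  have hA1 := analyticAt_dirDeriv hA (1, 0)
  have hc : ∀ᶠ p in 𝓝 (z₀ - y₀, y₀ - x₀),
      dirDeriv (1, 0) A p = dirDeriv (1, 0) A (z₀ - y₀, y₀ - x₀) := by
    refine eventually_eq_const_of_dirDeriv_eq_zero hA1 ?_
    -- The right-hand side L(y) - L(x) is free of z, so A₁ and B₁ satisfy the homogeneous equation.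
    have h0 := H.eventually_dirDeriv_eq_zero hx₀ hy₀ hA1 (analyticAt_dirDeriv hB (1, 0))
      (hd.mono fun w hw => hw.1)
    filter_upwards [eventually_of_eventually_diff (R := fun p =>
      dirDeriv (1, 0) (dirDeriv (1, 0) A) p = 0 ∧ dirDeriv (0, 1) (dirDeriv (1, 0) A) p = 0) h0]
      with p hp v
    have : v = v.1 • ((1, 0) : ℝ × ℝ) + v.2 • ((0, 1) : ℝ × ℝ) := by ext <;> simp
    have h1 := hp.1
    have h2 := hp.2
    rw [dirDeriv] at h1 h2 ⊢
    rw [this, map_add, map_smul, map_smul, h1, h2]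
    simp
  obtain ⟨a, ha⟩ : ∃ a, a = dirDeriv (1, 0) A (z₀ - y₀, y₀ - x₀) := ⟨_, rfl⟩
  rw [← ha] at hc
  have hca : ∀ᶠ w : ℝ × ℝ × ℝ in 𝓝 (x₀, y₀, z₀),
      dirDeriv (1, 0) A (w.2.2 - w.2.1, w.2.1 - w.1) = a :=
    cA.continuousAt.eventually (p := fun p => dirDeriv (1, 0) A p = a) hc
  have hd' : ∀ᶠ w : ℝ × ℝ × ℝ in 𝓝 (x₀, y₀, z₀),
      dirDeriv (1, 0) B (w.2.2 + φ w.2.1, w.2.1 + φ w.1) = a ∧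
      dirDeriv (0, 1) B (w.2.2 + φ w.2.1, w.2.1 + φ w.1) =
        dirDeriv (0, 1) A (w.2.2 - w.2.1, w.2.1 - w.1) +
          (deriv L w.2.1 - a * (1 + deriv φ w.2.1)) ∧
      dirDeriv (0, 1) A (w.2.2 - w.2.1, w.2.1 - w.1) * (1 + deriv φ w.1) =
        - deriv L w.1 - deriv φ w.1 * (deriv L w.2.1 - a * (1 + deriv φ w.2.1)) := by
    filter_upwards [hd, hca] with w ⟨h1, h2, h3⟩ h4
    rw [h1, h4] at h2
    have h5 : dirDeriv (0, 1) B (w.2.2 + φ w.2.1, w.2.1 + φ w.1) =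
        dirDeriv (0, 1) A (w.2.2 - w.2.1, w.2.1 - w.1) +
          (deriv L w.2.1 - a * (1 + deriv φ w.2.1)) := by linear_combination h2
    refine ⟨h1.trans h4, h5, ?_⟩
    rw [h5] at h3
    linear_combination h3
  have hL' : AnalyticOnNhd ℝ (deriv L) I := hL.deriv
  have hL'' : AnalyticOnNhd ℝ (deriv (deriv L)) I := hL'.deriv
  -- The translation device again: A₂ is fixed while x, y, z move together, and is then eliminated
  -- with the help of the undifferentiated relation.
  have hS : ∀ᶠ w : ℝ × ℝ × ℝ in 𝓝 (x₀, y₀, z₀),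
      deriv L w.1 * deriv (deriv φ) w.1 - (1 + deriv φ w.1) * deriv (deriv L) w.1 -
        deriv (deriv φ) w.1 * (deriv L w.2.1 - a * (1 + deriv φ w.2.1)) -
        (1 + deriv φ w.1) * deriv φ w.1 *
          (deriv (deriv L) w.2.1 - a * deriv (deriv φ) w.2.1) = 0 := by
    filter_upwards [eventually_deriv_eq (hd'.mono fun w hw => hw.2.2), hd', hI1, hI2]
      with ⟨x, y, z⟩ hw ⟨_, _, hw0⟩ hx hy
    simp only at hw hw0 hx hy ⊢
    have tr : ∀ (f : ℝ → ℝ), AnalyticOnNhd ℝ f I → ∀ t ∈ I,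
        HasDerivAt (fun r => f (t + r)) (deriv f t) 0 := fun f hf t ht =>
      HasDerivAt.comp_const_add t 0 (by simpa using (hf t ht).differentiableAt.hasDerivAt)
    have e := hw (fun r => (x + r, y + r, z + r)) 0
      (dirDeriv (0, 1) A (z - y, y - x) * deriv (deriv φ) x)
      (-deriv (deriv L) x - (deriv (deriv φ) x * (deriv L y - a * (1 + deriv φ y)) +
        deriv φ x * (deriv (deriv L) y - a * deriv (deriv φ) y))) (by simp) (by fun_prop)
      (by
        simp only [add_sub_add_right_eq_sub]
        exact ((tr _ H.analytic_deriv x hx).const_add 1).const_mul _)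
      (by
        have d := (tr _ hL' x hx).neg.sub ((tr _ H.analytic_deriv x hx).mul
          ((tr _ hL' y hy).sub (((tr _ H.analytic_deriv y hy).const_add 1).const_mul a)))
        simp only [add_zero, Pi.sub_apply] at d
        exact d)
    linear_combination deriv (deriv φ) x * hw0 - (1 + deriv φ x) * e
  have hS' := eq_zero_of_eventually_prod H.conn (T := fun x y =>
      deriv L x * deriv (deriv φ) x - (1 + deriv φ x) * deriv (deriv L) x -
        deriv (deriv φ) x * (deriv L y - a * (1 + deriv φ y)) -
        (1 + deriv φ x) * deriv φ x * (deriv (deriv L) y - a * deriv (deriv φ) y))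
      (fun y _ x hx => by
        have a1 := H.analytic_deriv x hx
        have a2 := H.analytic_deriv2 x hx
        have a3 := hL' x hx
        have a4 := hL'' x hx
        fun_prop)
      (fun x _ y hy => by
        have a1 := H.analytic_deriv y hy
        have a2 := H.analytic_deriv2 y hy
        have a3 := hL' y hy
        have a4 := hL'' y hy
        fun_prop) H.isOpen hx₀ hy₀ (eventually_prod_of_triple (R := fun x y =>
          deriv L x * deriv (deriv φ) x - (1 + deriv φ x) * deriv (deriv L) x -
          deriv (deriv φ) x * (deriv L y - a * (1 + deriv φ y)) -
          (1 + deriv φ x) * deriv φ x * (deriv (deriv L) y - a * deriv (deriv φ) y) = 0) hS)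
  -- For x = y the relation `hS'` collapses to -(1 + φ')² (L'' - a φ'') = 0.
  have h2 : ∀ x ∈ I, deriv (deriv L) x - a * deriv (deriv φ) x = 0 := by
    have an : AnalyticOnNhd ℝ (fun x => deriv (deriv L) x - a * deriv (deriv φ) x) I :=
      fun x hx => (hL'' x hx).sub (analyticAt_const.mul (H.analytic_deriv2 x hx))
    refine H.eq_zero_of_one_add_mul an (H.eq_zero_of_one_add_mul
      (fun x hx => (analyticAt_const.add (H.analytic_deriv x hx)).mul (an x hx))
      fun x hx => ?_)
    linear_combination - hS' x hx x hx
  obtain ⟨m, hm⟩ := eq_add_const_of_deriv_eq H.isOpen H.conn hL'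
    (g := fun x => a * (1 + deriv φ x))
    (fun x hx => analyticAt_const.mul (analyticAt_const.add (H.analytic_deriv x hx)))
    (fun x hx => by
      have := h2 x hx
      rw [deriv_const_mul _ ((H.analytic_deriv x hx).differentiableAt.const_add 1),
        deriv_const_add]
      linarith)
  -- Inserting L' = a(1 + φ') + m turns the relation for A₂ into (A₂ + a + m)(1 + φ'(x)) = 0.
  have hA2 : ∀ᶠ w : ℝ × ℝ × ℝ in 𝓝 (x₀, y₀, z₀),
      dirDeriv (0, 1) A (w.2.2 - w.2.1, w.2.1 - w.1) + (a + m) = 0 := by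
    refine H.eventually_eq_zero_of_mul (E := fun p => dirDeriv (0, 1) A p + (a + m)) hx₀
      ((analyticAt_dirDeriv hA (0, 1)).add analyticAt_const) ?_
    filter_upwards [hd', hI1, hI2] with w ⟨_, _, hw⟩ hx hy
    rw [hm _ hx, hm _ hy] at hw
    linear_combination hw
  refine ⟨a, m, hm, ?_⟩
  filter_upwards [hca, hA2, hd', hI2] with w h1 h2 ⟨h3, h4, _⟩ hy
  rw [hm _ hy] at h4
  exact ⟨h1, by linarith, h3, by linarith⟩

/-! ### The functional equation for functions on a domain -/

section Domain

variable {V : Type*} [NormedAddCommGroup V] [NormedSpace ℝ V]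

/-- A function whose derivatives along `ker π` vanish is locally a function of `π`. -/
theorem eventually_eq_section {π : V →L[ℝ] ℝ × ℝ} {σ : ℝ × ℝ →L[ℝ] V} (hπσ : ∀ v, π (σ v) = v)
    {Q : V → ℝ} {p₀ : V} (hQ : AnalyticAt ℝ Q p₀)
    (hker : ∀ᶠ p in 𝓝 p₀, ∀ v, π v = 0 → dirDeriv v Q p = 0) :
    ∀ᶠ p in 𝓝 p₀, Q p = Q (p₀ + σ (π p - π p₀)) := by
  obtain ⟨ε, hε, hb⟩ := Metric.eventually_nhds_iff_ball.1 (hker.and hQ.eventually_analyticAt)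
  have c : ContinuousAt (fun p => p₀ + σ (π p - π p₀)) p₀ := by fun_prop
  have hc : ∀ᶠ p in 𝓝 p₀, p₀ + σ (π p - π p₀) ∈ Metric.ball p₀ ε :=
    c.eventually_mem (by simpa using Metric.ball_mem_nhds p₀ hε)
  filter_upwards [Metric.ball_mem_nhds p₀ hε, hc] with p hp hq
  set q := p₀ + σ (π p - π p₀) with hqd
  -- The segment from q to p runs in a kernel direction of π and stays in the ball by convexity. The
  -- argument is only local because fibres of π in a general domain may be disconnected.
  have hseg : ∀ r ∈ Icc (0 : ℝ) 1, q + r • (p - q) ∈ Metric.ball p₀ ε := fun r hr =>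
    (convex_ball p₀ ε).add_smul_sub_mem hq hp hr
  have hz : π (p - q) = 0 := by simp [hqd, hπσ]
  have hd : ∀ r ∈ Icc (0 : ℝ) 1, HasDerivAt (fun r : ℝ => Q (q + r • (p - q))) 0 r := by
    intro r hr
    obtain ⟨h1, h2⟩ := hb _ (hseg r hr)
    rw [← h1 _ hz]
    refine hasDerivAt_comp_curve ?_ rfl h2
    simpa using ((hasDerivAt_id' r).smul_const (p - q)).const_add q
  have := constant_of_has_deriv_right_zero (f := fun r : ℝ => Q (q + r • (p - q))) (a := 0) (b := 1)
    (fun r hr => (hd r hr).continuousAt.continuousWithinAt)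
    (fun r hr => (hd r (Ico_subset_Icc_self hr)).hasDerivWithinAt) 1 (by simp)
  simpa using this

/-- The chain rule for A ∘ π; it carries the derivatives found for the germs back to Q. -/
theorem dirDeriv_congr_section {π : V →L[ℝ] ℝ × ℝ} {Q : V → ℝ} {p : V} {A : ℝ × ℝ → ℝ}
    (hA : AnalyticAt ℝ A (π p)) (h : ∀ᶠ q in 𝓝 p, Q q = A (π q)) (v : V) :
    dirDeriv v Q p = dirDeriv (π v) A (π p) := by
  have h' : Q =ᶠ[𝓝 p] A ∘ π := h
  unfold dirDeriv
  rw [h'.fderiv_eq, fderiv_comp p hA.differentiableAt π.differentiableAt]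
  simp

/-- The functional equation for two functions that are locally functions of `π`. -/
theorem Admissible.local_functional_equation (H : Admissible φ I) (hL : AnalyticOnNhd ℝ L I)
    {π : V →L[ℝ] ℝ × ℝ} {σ : ℝ × ℝ →L[ℝ] V} (hπσ : ∀ v, π (σ v) = v) {Q Q' : V → ℝ}
    {P P' : ℝ × ℝ × ℝ → V} {x₀ y₀ z₀ : ℝ} (hx₀ : x₀ ∈ I) (hy₀ : y₀ ∈ I)
    (hP : ContinuousAt P (x₀, y₀, z₀)) (hP' : ContinuousAt P' (x₀, y₀, z₀))
    (hQ : AnalyticAt ℝ Q (P (x₀, y₀, z₀))) (hQ' : AnalyticAt ℝ Q' (P' (x₀, y₀, z₀)))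
    (hker : ∀ᶠ p in 𝓝 (P (x₀, y₀, z₀)), ∀ v, π v = 0 → dirDeriv v Q p = 0)
    (hker' : ∀ᶠ p in 𝓝 (P' (x₀, y₀, z₀)), ∀ v, π v = 0 → dirDeriv v Q' p = 0)
    (hπ : ∀ w, π (P w) = (w.2.2 - w.2.1, w.2.1 - w.1))
    (hπ' : ∀ w, π (P' w) = (w.2.2 + φ w.2.1, w.2.1 + φ w.1))
    (h : ∀ᶠ w in 𝓝 (x₀, y₀, z₀), Q' (P' w) - Q (P w) = L w.2.1 - L w.1) :
    ∃ a m : ℝ, (∀ x ∈ I, deriv L x = a * (1 + deriv φ x) + m) ∧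
      (∀ᶠ p in 𝓝 (P (x₀, y₀, z₀)), ∀ v, dirDeriv v Q p = a * (π v).1 - (a + m) * (π v).2) ∧
      ∀ v, dirDeriv v Q' (P' (x₀, y₀, z₀)) = a * ((π v).1 - (π v).2) := by
  have hs := eventually_eq_section hπσ hQ hker
  have hs' := eventually_eq_section hπσ hQ' hker'
  set p₀ := P (x₀, y₀, z₀) with hp₀
  set p₀' := P' (x₀, y₀, z₀) with hp₀'
  have e0 : π p₀ = (z₀ - y₀, y₀ - x₀) := hπ _
  have e0' : π p₀' = (z₀ + φ y₀, y₀ + φ x₀) := hπ' _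
  -- The germs A and B are Q and Q' restricted to affine slices through the two base points,
  -- parallel to the image of σ.
  have aff : ∀ (R : V → ℝ) (p : V), AnalyticAt ℝ R p →
      AnalyticAt ℝ (fun w => R (p + σ (w - π p))) (π p) := by
    intro R p hR
    have h1 : AnalyticAt ℝ (fun w : ℝ × ℝ => p + σ (w - π p)) (π p) :=
      analyticAt_const.add
        ((σ.analyticAt _).comp (f := fun w => w - π p) (analyticAt_id.sub analyticAt_const))
    exact AnalyticAt.comp (f := fun w : ℝ × ℝ => p + σ (w - π p)) (g := R) (by simpa using hR) h1
  have hA := aff Q p₀ hQ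
  have hB := aff Q' p₀' hQ'
  have hA' : AnalyticAt ℝ (fun w => Q (p₀ + σ (w - π p₀))) (z₀ - y₀, y₀ - x₀) := by
    rw [← e0]; exact hA
  have hB' : AnalyticAt ℝ (fun w => Q' (p₀' + σ (w - π p₀'))) (z₀ + φ y₀, y₀ + φ x₀) := by
    rw [← e0']; exact hB
  obtain ⟨a, m, h1, h2⟩ := H.functional_equation hL hx₀ hy₀ hA' hB' (by
    filter_upwards [h, hP.eventually hs, hP'.eventually hs'] with w h1 h2 h3
    rw [h2, h3, hπ, hπ'] at h1
    exact h1)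
  have lin : ∀ (R : ℝ × ℝ → ℝ) (p v : ℝ × ℝ),
      dirDeriv v R p = v.1 * dirDeriv (1, 0) R p + v.2 * dirDeriv (0, 1) R p := by
    intro R p v
    have : v = v.1 • ((1, 0) : ℝ × ℝ) + v.2 • ((0, 1) : ℝ × ℝ) := by ext <;> simp
    unfold dirDeriv
    conv_lhs => rw [this, map_add, map_smul, map_smul, smul_eq_mul, smul_eq_mul]
  refine ⟨a, m, h1, ?_, fun v => ?_⟩
  · have h3 := eventually_of_eventually_diff (R := fun q =>
      dirDeriv (1, 0) (fun w => Q (p₀ + σ (w - π p₀))) q = a ∧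
      dirDeriv (0, 1) (fun w => Q (p₀ + σ (w - π p₀))) q = -(a + m))
      (h2.mono fun w hw => ⟨hw.1, hw.2.1⟩)
    rw [← e0] at h3
    filter_upwards [hs.eventually_nhds, π.continuous.continuousAt.eventually h3,
      π.continuous.continuousAt.eventually hA.eventually_analyticAt] with p q1 q2 q3 v
    rw [dirDeriv_congr_section q3 q1, lin, q2.1, q2.2]
    ring
  · have h3 := h2.self_of_nhds
    simp only [← e0'] at h3
    rw [dirDeriv_congr_section hB hs', lin, h3.2.2.1, h3.2.2.2]
    ring

/-- The functional equation for one function on a domain. -/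
theorem Admissible.global_functional_equation (H : Admissible φ I) (hL : AnalyticOnNhd ℝ L I)
    {π : V →L[ℝ] ℝ × ℝ} {σ : ℝ × ℝ →L[ℝ] V} (hπσ : ∀ v, π (σ v) = v) {Ω : Set V}
    (hΩ : IsOpen Ω) (hΩc : IsPreconnected Ω) {Q : V → ℝ} (hQ : AnalyticOnNhd ℝ Q Ω)
    (hker : ∀ p ∈ Ω, ∀ v, π v = 0 → dirDeriv v Q p = 0)
    {P P' : ℝ × ℝ × ℝ → V} {x₀ y₀ z₀ : ℝ} (hx₀ : x₀ ∈ I) (hy₀ : y₀ ∈ I)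
    (hP : ContinuousAt P (x₀, y₀, z₀)) (hP' : ContinuousAt P' (x₀, y₀, z₀))
    (hPΩ : P (x₀, y₀, z₀) ∈ Ω) (hPΩ' : P' (x₀, y₀, z₀) ∈ Ω)
    (hπ : ∀ w, π (P w) = (w.2.2 - w.2.1, w.2.1 - w.1))
    (hπ' : ∀ w, π (P' w) = (w.2.2 + φ w.2.1, w.2.1 + φ w.1))
    (h : ∀ᶠ w in 𝓝 (x₀, y₀, z₀), Q (P' w) - Q (P w) = L w.2.1 - L w.1) :
    ∃ a : ℝ, (∀ x ∈ I, deriv L x = a * (1 + deriv φ x)) ∧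
      ∀ p ∈ Ω, ∀ v, dirDeriv v Q p = a * ((π v).1 - (π v).2) := by
  obtain ⟨a, m, h1, h2, h3⟩ := H.local_functional_equation hL hπσ hx₀ hy₀ hP hP' (hQ _ hPΩ)
    (hQ _ hPΩ') (by filter_upwards [hΩ.mem_nhds hPΩ] using hker)
    (by filter_upwards [hΩ.mem_nhds hPΩ'] using hker) hπ hπ' h
  -- The derivatives are constant near one point, hence on the whole connected domain.
  have h4 : ∀ p ∈ Ω, ∀ v, dirDeriv v Q p = a * (π v).1 - (a + m) * (π v).2 := by
    intro p hp v
    have := eq_zero_on_of_eventually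
      (f := fun p => dirDeriv v Q p - (a * (π v).1 - (a + m) * (π v).2))
      ((analyticOnNhd_dirDeriv hQ v).sub analyticOnNhd_const) hΩc hPΩ
      (h2.mono fun q hq => by rw [hq v, sub_self]) p hp
    linarith
  -- The derivative along σ(0, 1) is -(a + m) by continuation from P, but -a as read off at P'.
  have h5 : m = 0 := by
    have e1 := h4 _ hPΩ' (σ (0, 1))
    rw [h3 (σ (0, 1)), hπσ] at e1
    simp at e1
    linarith
  subst h5
  exact ⟨a, fun x hx => by rw [h1 x hx, add_zero], fun p hp v => by rw [h4 p hp v]; ring⟩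

end Domain

/-- The functions 1 + φ' and 1 are linearly independent on I, because φ' is not constant. -/
theorem Admissible.coeff_unique (H : Admissible φ I) {a b c : ℝ}
    (h : ∀ x ∈ I, a * (1 + deriv φ x) = b * (1 + deriv φ x) + c) : a = b := by
  by_contra hne
  have hab : a - b ≠ 0 := sub_ne_zero.2 hne
  refine H.deriv_not_const (c / (a - b) - 1) fun z hz => ?_
  have := h z hz
  field_simp
  linarith

section Domain

variable {V : Type*} [NormedAddCommGroup V] [NormedSpace ℝ V]

theorem dirDeriv_log {K : V → ℝ} {p : V} (hK : AnalyticAt ℝ K p) (h : K p ≠ 0) (v : V) :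
    dirDeriv v (fun q => Real.log (K q)) p = (K p)⁻¹ * dirDeriv v K p := by
  unfold dirDeriv
  rw [fderiv.log hK.differentiableAt h]
  simp

/-- If `G_{v₀}` and `G_{v₁}` satisfy the relations that the compatibility condition imposes on
`G_{u₁₀}` and `G_{u₋₁₀}`, then `G_{v₁}` vanishes. -/
theorem Admissible.false_of_relations (H : Admissible φ I) {α γ : ℝ} (hα : α ≠ 0)
    (hlog : ∀ z ∈ I, Real.log (deriv φ z) = α * (φ z + z) + γ)
    {π : V →L[ℝ] ℝ × ℝ} {σ : ℝ × ℝ →L[ℝ] V} (hπσ : ∀ v, π (σ v) = v) {Ω : Set V}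
    (hΩ : IsOpen Ω) (hΩc : IsPreconnected Ω) {G : V → ℝ} (hG : AnalyticOnNhd ℝ G Ω) {v₀ v₁ : V}
    (hv₀ : π v₀ = (1, 0))
    (hker₀ : ∀ p ∈ Ω, ∀ v, π v = 0 → dirDeriv v (dirDeriv v₀ G) p = 0)
    (hker₁ : ∀ p ∈ Ω, ∀ v, π v = 0 → dirDeriv v (dirDeriv v₁ G) p = 0)
    {P P' R R' : ℝ × ℝ × ℝ → V} {x₀ y₀ z₀ x₁ y₁ z₁ : ℝ} (hx₀ : x₀ ∈ I) (hy₀ : y₀ ∈ I)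
    (hx₁ : x₁ ∈ I) (hy₁ : y₁ ∈ I)
    (hP : ContinuousAt P (x₀, y₀, z₀)) (hP' : ContinuousAt P' (x₀, y₀, z₀))
    (hPΩ : P (x₀, y₀, z₀) ∈ Ω) (hPΩ' : P' (x₀, y₀, z₀) ∈ Ω)
    (hPπ : ∀ w, π (P w) = (w.2.2 - w.2.1, w.2.1 - w.1))
    (hPπ' : ∀ w, π (P' w) = (w.2.2 + φ w.2.1, w.2.1 + φ w.1))
    (h₀ : ∀ᶠ w in 𝓝 (x₀, y₀, z₀), dirDeriv v₀ G (P' w) = dirDeriv v₀ G (P w))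
    (hR : ContinuousAt R (x₁, y₁, z₁)) (hR' : ContinuousAt R' (x₁, y₁, z₁))
    (hRΩ : R (x₁, y₁, z₁) ∈ Ω) (hRΩ' : R' (x₁, y₁, z₁) ∈ Ω)
    (hRπ : ∀ w, π (R w) = (w.2.2 - w.2.1, w.2.1 - w.1))
    (hRπ' : ∀ w, π (R' w) = (w.2.2 + φ w.2.1, w.2.1 + φ w.1))
    (h₁ : ∀ᶠ w in 𝓝 (x₁, y₁, z₁),
      dirDeriv v₁ G (R' w) * deriv φ w.1 = dirDeriv v₁ G (R w) * deriv φ w.2.1) :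
    dirDeriv v₁ G (R (x₁, y₁, z₁)) = 0 := by
  by_contra hne
  -- The equation for G_{v₀} is the case L = 0, where a(1 + φ') = 0 forces a = 0.
  obtain ⟨a, ha, hc⟩ := H.global_functional_equation (L := fun _ => 0) analyticOnNhd_const hπσ hΩ
    hΩc (analyticOnNhd_dirDeriv hG v₀) hker₀ hx₀ hy₀ hP hP' hPΩ hPΩ' hPπ hPπ'
    (h₀.mono fun w hw => by rw [hw]; ring)
  have ha0 : a = 0 := H.coeff_unique (c := 0) fun x hx => by
    rw [← ha x hx]; simp
  have hK := analyticOnNhd_dirDeriv hG v₁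
  -- Logarithms are needed at both points, and `h₁` carries nonvanishing from R to R'.
  have hne' : dirDeriv v₁ G (R' (x₁, y₁, z₁)) ≠ 0 := fun h0 => by
    have := h₁.self_of_nhds
    rw [h0, zero_mul] at this
    exact (mul_ne_zero hne (H.deriv_ne y₁ hy₁)) this.symm
  have hker : ∀ p ∈ Ω, dirDeriv v₁ G p ≠ 0 → ∀ᶠ q in 𝓝 p, ∀ v, π v = 0 →
      dirDeriv v (fun q => Real.log (dirDeriv v₁ G q)) q = 0 := by
    intro p hp hpne
    filter_upwards [hΩ.mem_nhds hp, (hK p hp).continuousAt.eventually_ne hpne] with q hq hqne v hv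
    rw [dirDeriv_log (hK q hq) hqne, hker₁ q hq v hv, mul_zero]
  have hLd : ∀ x ∈ I, deriv (fun z => α * (φ z + z)) x = α * (1 + deriv φ x) := fun x hx => by
    have := ((H.analytic x hx).differentiableAt.hasDerivAt.add (hasDerivAt_id' x)).const_mul α
    rw [add_comm 1]
    exact this.deriv
  -- Only the local form applies: G_{v₁} may vanish elsewhere in Ω, so its logarithm need not be
  -- analytic on a connected set containing both points.
  obtain ⟨b, m, hb, hd, -⟩ := H.local_functional_equation (L := fun z => α * (φ z + z))
    (fun x hx => analyticAt_const.mul ((H.analytic x hx).add analyticAt_id)) hπσ hx₁ hy₁ hR hR'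
    (analyticAt_log_of_ne_zero (hK _ hRΩ) hne) (analyticAt_log_of_ne_zero (hK _ hRΩ') hne')
    (hker _ hRΩ hne) (hker _ hRΩ' hne') hRπ hRπ' (by
      have cx : ContinuousAt (fun w : ℝ × ℝ × ℝ => w.1) (x₁, y₁, z₁) := by fun_prop
      have cy : ContinuousAt (fun w : ℝ × ℝ × ℝ => w.2.1) (x₁, y₁, z₁) := by fun_prop
      filter_upwards [h₁, hR.eventually ((hK _ hRΩ).continuousAt.eventually_ne hne),
        hR'.eventually ((hK _ hRΩ').continuousAt.eventually_ne hne'),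
        cx.eventually_mem (H.isOpen.mem_nhds hx₁), cy.eventually_mem (H.isOpen.mem_nhds hy₁)]
        with w hw n1 n2 hx hy
      have := congrArg Real.log hw
      rw [Real.log_mul n2 (H.deriv_ne _ hx), Real.log_mul n1 (H.deriv_ne _ hy), hlog _ hx,
        hlog _ hy] at this
      linarith)
  have hbα : α = b := H.coeff_unique fun x hx => (hLd x hx).symm.trans (hb x hx)
  -- The v₀-derivative of log |G_{v₁}| is α, yet by symmetry of second derivatives it is a multiple
  -- of the v₁-derivative of G_{v₀}, which is zero.
  have e := hd.self_of_nhds v₀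
  rw [dirDeriv_log (hK _ hRΩ) hne, dirDeriv_comm (hG _ hRΩ), hc _ hRΩ, hv₀, ha0, ← hbα] at e
  simp at e
  exact hα e.symm

end Domain

/-! ### Transfer of vanishing along parametrizations -/

/-- A nonzero analytic function on a domain, pulled back along a map with a continuous section, is
nonzero at points arbitrarily close to a given one. -/
theorem frequently_ne_zero {V W : Type*} [NormedAddCommGroup V] [NormedSpace ℝ V]
    [TopologicalSpace W] {f : V → ℝ} {Ω : Set V} (hf : AnalyticOnNhd ℝ f Ω) (hΩ : IsPreconnected Ω)
    (hne : ∃ p ∈ Ω, f p ≠ 0) {P : W → V} {S : V → W} {w₀ : W} (hP : P w₀ ∈ Ω)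
    (hS : ContinuousAt S (P w₀)) (hSw : S (P w₀) = w₀) (hPS : ∀ p, P (S p) = p) :
    ∃ᶠ w in 𝓝 w₀, f (P w) ≠ 0 := by
  intro h
  obtain ⟨p, hp, hpn⟩ := hne
  refine hpn (eq_zero_on_of_eventually hf hΩ hP ?_ p hp)
  rw [← hSw] at h
  filter_upwards [hS.eventually h] with q hq
  simpa [hPS] using hq

/-- An analytic function that vanishes along a map with a local continuous section vanishes. -/
theorem eq_zero_of_eventually_comp {V W : Type*} [NormedAddCommGroup V] [NormedSpace ℝ V]
    [TopologicalSpace W] {f : V → ℝ} {Ω : Set V} (hf : AnalyticOnNhd ℝ f Ω) (hΩ : IsPreconnected Ω)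
    {P : W → V} {S : V → W} {w₀ : W} (hP : P w₀ ∈ Ω) (hS : ContinuousAt S (P w₀))
    (hSw : S (P w₀) = w₀) (hPS : ∀ᶠ p in 𝓝 (P w₀), P (S p) = p)
    (h : ∀ᶠ w in 𝓝 w₀, f (P w) = 0) : ∀ p ∈ Ω, f p = 0 := by
  refine eq_zero_on_of_eventually hf hΩ hP ?_
  have h' : ∀ᶠ w in 𝓝 (S (P w₀)), f (P w) = 0 := by rwa [hSw]
  filter_upwards [hS.eventually h', hPS] with q hq hq'
  rwa [hq'] at hq

/-! ### Symmetries along one direction -/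

/-- The `k`-th coordinate. -/
noncomputable def coord {n : ℕ} (k : Fin n) : (Fin n → ℝ) →L[ℝ] ℝ := ContinuousLinearMap.proj k

/-- The differences of consecutive coordinates of `(u₂₀, u₁₀, u₀₀)`. -/
noncomputable def rowDiff : (Fin 3 → ℝ) →L[ℝ] ℝ × ℝ :=
  ContinuousLinearMap.prod (coord 0 - coord 1) (coord 1 - coord 2)

theorem rowDiff_apply (v : Fin 3 → ℝ) : rowDiff v = (v 0 - v 1, v 1 - v 2) := rfl

/-- A section of `rowDiff`. -/
noncomputable def rowDiffSection : ℝ × ℝ →L[ℝ] (Fin 3 → ℝ) :=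
  ContinuousLinearMap.pi ![ContinuousLinearMap.fst ℝ ℝ ℝ + ContinuousLinearMap.snd ℝ ℝ ℝ,
    ContinuousLinearMap.snd ℝ ℝ ℝ, 0]

theorem rowDiff_section (v : ℝ × ℝ) : rowDiff (rowDiffSection v) = v := by
  simp [rowDiff_apply, rowDiffSection]

theorem dirDeriv_eq_zero_of_rowDiff {f : (Fin 3 → ℝ) → ℝ} {p v : Fin 3 → ℝ}
    (h : dirDeriv ![1, 1, 1] f p = 0) (hv : rowDiff v = 0) : dirDeriv v f p = 0 := by
  rw [rowDiff_apply, Prod.mk_eq_zero] at hv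
  have : v = v 0 • ![1, 1, 1] := by
    ext i
    fin_cases i <;> simp <;> linarith
  unfold dirDeriv at h ⊢
  rw [this, map_smul, h, smul_zero]

theorem hasDerivAt_vec3 {a b c : ℝ → ℝ} {a' b' c' s : ℝ} (ha : HasDerivAt a a' s)
    (hb : HasDerivAt b b' s) (hc : HasDerivAt c c' s) :
    HasDerivAt (fun r => ![a r, b r, c r]) ![a', b', c'] s := by
  refine hasDerivAt_pi.2 fun i => ?_
  fin_cases i <;> simpa

theorem continuousAt_vec3 {W : Type*} [TopologicalSpace W] {a b c : W → ℝ} {w : W}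
    (ha : ContinuousAt a w) (hb : ContinuousAt b w) (hc : ContinuousAt c w) :
    ContinuousAt (fun r => ![a r, b r, c r]) w := by
  refine continuousAt_pi.2 fun i => ?_
  fin_cases i <;> simpa

/-! In this section `w = (u₀₀, u₁₀, u₂₀, u₋₁₀, u₀₁)`. -/

/-- The triple `(u₂₁, u₁₁, u₀₁)`. -/
def upperRight (φ : ℝ → ℝ) (w : ℝ × ℝ × ℝ × ℝ × ℝ) : Fin 3 → ℝ :=
  ![w.2.2.1 + (w.2.1 + w.2.2.2.2 + φ w.1) + φ w.2.1, w.2.1 + w.2.2.2.2 + φ w.1, w.2.2.2.2]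

/-- The triple `(u₂₀, u₁₀, u₀₀)`. -/
def lowerRight (w : ℝ × ℝ × ℝ × ℝ × ℝ) : Fin 3 → ℝ := ![w.2.2.1, w.2.1, w.1]

/-- The triple `(u₁₀, u₀₀, u₋₁₀)`. -/
def lowerLeft (w : ℝ × ℝ × ℝ × ℝ × ℝ) : Fin 3 → ℝ := ![w.2.1, w.1, w.2.2.2.1]

/-- The triple `(u₁₁, u₀₁, u₋₁₁)`. -/
def upperLeft (φ : ℝ → ℝ) (w : ℝ × ℝ × ℝ × ℝ × ℝ) : Fin 3 → ℝ :=
  ![w.2.1 + w.2.2.2.2 + φ w.1, w.2.2.2.2, w.2.2.2.2 - w.1 - φ w.2.2.2.1]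

/-- The conditions under which the terms of the compatibility condition are defined. -/
def RowDefined (φ : ℝ → ℝ) (I : Set ℝ) (Ω : Set (Fin 3 → ℝ)) (w : ℝ × ℝ × ℝ × ℝ × ℝ) : Prop :=
  (w.1 ∈ I ∧ w.2.1 ∈ I ∧ w.2.2.2.1 ∈ I) ∧
    upperRight φ w ∈ Ω ∧ lowerRight w ∈ Ω ∧ lowerLeft w ∈ Ω ∧ upperLeft φ w ∈ Ω

theorem Admissible.continuousAt_row (H : Admissible φ I) {w : ℝ × ℝ × ℝ × ℝ × ℝ}
    (h : w.1 ∈ I ∧ w.2.1 ∈ I ∧ w.2.2.2.1 ∈ I) :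
    ContinuousAt (upperRight φ) w ∧ ContinuousAt lowerRight w ∧ ContinuousAt lowerLeft w ∧
      ContinuousAt (upperLeft φ) w := by
  have c1 := (H.analytic _ h.1).continuousAt
  have c2 := (H.analytic _ h.2.1).continuousAt
  have c3 := (H.analytic _ h.2.2).continuousAt
  exact ⟨continuousAt_vec3 (by fun_prop) (by fun_prop) (by fun_prop),
    continuousAt_vec3 (by fun_prop) (by fun_prop) (by fun_prop),
    continuousAt_vec3 (by fun_prop) (by fun_prop) (by fun_prop),
    continuousAt_vec3 (by fun_prop) (by fun_prop) (by fun_prop)⟩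

theorem Admissible.eventually_rowDefined (H : Admissible φ I) {Ω : Set (Fin 3 → ℝ)}
    (hΩ : IsOpen Ω) {w : ℝ × ℝ × ℝ × ℝ × ℝ} (h : RowDefined φ I Ω w) :
    ∀ᶠ w' in 𝓝 w, RowDefined φ I Ω w' := by
  obtain ⟨hI, h1, h2, h3, h4⟩ := h
  obtain ⟨c1, c2, c3, c4⟩ := H.continuousAt_row hI
  have d1 : ContinuousAt (fun w : ℝ × ℝ × ℝ × ℝ × ℝ => w.1) w := by fun_prop
  have d2 : ContinuousAt (fun w : ℝ × ℝ × ℝ × ℝ × ℝ => w.2.1) w := by fun_prop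
  have d3 : ContinuousAt (fun w : ℝ × ℝ × ℝ × ℝ × ℝ => w.2.2.2.1) w := by fun_prop
  exact ((d1.eventually_mem (H.isOpen.mem_nhds hI.1)).and
    ((d2.eventually_mem (H.isOpen.mem_nhds hI.2.1)).and
      (d3.eventually_mem (H.isOpen.mem_nhds hI.2.2)))).and
    ((c1.eventually_mem (hΩ.mem_nhds h1)).and ((c2.eventually_mem (hΩ.mem_nhds h2)).and
      ((c3.eventually_mem (hΩ.mem_nhds h3)).and (c4.eventually_mem (hΩ.mem_nhds h4)))))

/-- The triple (u₂₁, u₁₁, u₀₁) can be prescribed near its value with u₀₀ held fixed: u₁₀ and then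
u₂₀ are solved from the equation, in which they occur linearly. -/
theorem Admissible.eq_zero_of_upperRight (H : Admissible φ I) {Ω : Set (Fin 3 → ℝ)}
    (hΩc : IsPreconnected Ω) {f : (Fin 3 → ℝ) → ℝ} (hf : AnalyticOnNhd ℝ f Ω)
    {w₀ : ℝ × ℝ × ℝ × ℝ × ℝ} (hw₀ : w₀.2.1 ∈ I) (h1 : upperRight φ w₀ ∈ Ω)
    (h : ∀ᶠ w in 𝓝 w₀, f (upperRight φ w) = 0) : ∀ p ∈ Ω, f p = 0 := by
  obtain ⟨x, a, a₂, m, b⟩ := w₀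
  have e : a + b + φ x - b - φ x = a := by ring
  refine eq_zero_of_eventually_comp hf hΩc (P := upperRight φ)
    (S := fun p => (x, p 1 - p 2 - φ x, p 0 - p 1 - φ (p 1 - p 2 - φ x), m, p 2)) h1 ?_ ?_ ?_ h
  · have e' : upperRight φ (x, a, a₂, m, b) 1 - upperRight φ (x, a, a₂, m, b) 2 - φ x = a := e
    have c : ContinuousAt (fun p : Fin 3 → ℝ => φ (p 1 - p 2 - φ x))
        (upperRight φ (x, a, a₂, m, b)) :=
      ContinuousAt.comp_of_eq (f := fun p : Fin 3 → ℝ => p 1 - p 2 - φ x)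
        (H.analytic a hw₀).continuousAt (by fun_prop) e'
    exact continuousAt_const.prodMk (ContinuousAt.prodMk (by fun_prop)
      (ContinuousAt.prodMk (ContinuousAt.sub (by fun_prop) c)
        (continuousAt_const.prodMk (continuous_apply 2).continuousAt)))
  · simp [upperRight, e]
    ring
  · refine Eventually.of_forall fun p => ?_
    ext i
    fin_cases i <;> simp [upperRight] <;> ring

/-- A function `Φ (u₁₀, u₀₀, u₋₁₀)` that satisfies the compatibility condition does not depend on
`u₋₁₀`. -/
theorem Admissible.row_symmetry (H : Admissible φ I) {α γ : ℝ} (hα : α ≠ 0)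
    (hlog : ∀ z ∈ I, Real.log (deriv φ z) = α * (φ z + z) + γ) {Ω : Set (Fin 3 → ℝ)}
    (hΩ : IsOpen Ω) (hΩc : IsPreconnected Ω) {Φ : (Fin 3 → ℝ) → ℝ} (hΦ : AnalyticOnNhd ℝ Φ Ω)
    (hex : ∃ w, RowDefined φ I Ω w)
    (hsym : ∀ w, RowDefined φ I Ω w →
      Φ (upperRight φ w) =
        Φ (lowerRight w) + Φ (lowerLeft w) * deriv φ w.1 + Φ (upperLeft φ w)) :
    ∀ p ∈ Ω, dirDeriv ![0, 0, 1] Φ p = 0 := by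
  by_contra! hne
  obtain ⟨w₀, hw₀⟩ := hex
  have hQ := analyticOnNhd_dirDeriv hΦ ![1, 0, 0]
  have hK := analyticOnNhd_dirDeriv hΦ ![0, 0, 1]
  have hrel : ∀ w, RowDefined φ I Ω w → ∀ᶠ w' in 𝓝 w, Φ (upperRight φ w') =
      Φ (lowerRight w') + Φ (lowerLeft w') * deriv φ w'.1 + Φ (upperLeft φ w') :=
    fun w hw => (H.eventually_rowDefined hΩ hw).mono hsym
  -- Derivative in u₂₀, on which only u₂₁ and u₂₀ itself depend.
  have hR₀ : ∀ w, RowDefined φ I Ω w →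
      dirDeriv ![1, 0, 0] Φ (upperRight φ w) = dirDeriv ![1, 0, 0] Φ (lowerRight w) := by
    intro w hw
    have hd := (eventually_deriv_eq (hrel w hw)).self_of_nhds
    obtain ⟨x, a, a₂, m, b⟩ := w
    obtain ⟨hI, h1, h2, h3, h4⟩ := hw
    have e := hd (fun r => (x, a, r, m, b)) a₂ _ _ rfl (by fun_prop)
      (hasDerivAt_comp_curve (hasDerivAt_vec3
        (((hasDerivAt_id' a₂).add_const (a + b + φ x)).add_const (φ a))
        (hasDerivAt_const a₂ (a + b + φ x)) (hasDerivAt_const a₂ b)) rfl (hΦ _ h1))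
      (((hasDerivAt_comp_curve (hasDerivAt_vec3 (hasDerivAt_id' a₂) (hasDerivAt_const a₂ a)
        (hasDerivAt_const a₂ x)) rfl (hΦ _ h2)).add_const
          (Φ (lowerLeft (x, a, a₂, m, b)) * deriv φ x)).add_const
          (Φ (upperLeft φ (x, a, a₂, m, b))))
    exact e
  -- Derivative in u₋₁₀, which also enters u₋₁₁ = u₀₁ - u₀₀ - φ(u₋₁₀).
  have hR₁ : ∀ w, RowDefined φ I Ω w →
      dirDeriv ![0, 0, 1] Φ (upperLeft φ w) * deriv φ w.2.2.2.1 =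
        dirDeriv ![0, 0, 1] Φ (lowerLeft w) * deriv φ w.1 := by
    intro w hw
    have hd := (eventually_deriv_eq (hrel w hw)).self_of_nhds
    obtain ⟨x, a, a₂, m, b⟩ := w
    obtain ⟨hI, h1, h2, h3, h4⟩ := hw
    have e := hd (fun r => (x, a, a₂, r, b)) m _ _ rfl (by fun_prop)
      (hasDerivAt_const m (Φ (upperRight φ (x, a, a₂, m, b))))
      ((((hasDerivAt_comp_curve (hasDerivAt_vec3 (hasDerivAt_const m a) (hasDerivAt_const m x)
        (hasDerivAt_id' m)) rfl (hΦ _ h3)).mul_const (deriv φ x)).const_add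
          (Φ (lowerRight (x, a, a₂, m, b)))).add
        (hasDerivAt_comp_curve (hasDerivAt_vec3 (hasDerivAt_const m (a + b + φ x))
          (hasDerivAt_const m b)
          ((H.analytic m hI.2.2).differentiableAt.hasDerivAt.const_sub (b - x))) rfl (hΦ _ h4)))
    have e1 : dirDeriv ![0, 0, -deriv φ m] Φ (upperLeft φ (x, a, a₂, m, b)) =
        - deriv φ m * dirDeriv ![0, 0, 1] Φ (upperLeft φ (x, a, a₂, m, b)) := by
      have : (![0, 0, -deriv φ m] : Fin 3 → ℝ) = (-deriv φ m) • ![0, 0, 1] := by simp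
      unfold dirDeriv
      rw [this, map_smul, smul_eq_mul]
    rw [e1] at e
    change 0 = dirDeriv ![0, 0, 1] Φ (lowerLeft (x, a, a₂, m, b)) * deriv φ x + _ at e
    simp only
    linarith
  -- Derivative of `hR₀` in u₀₁: the upper triple moves along (1, 1, 1), while the lower one is
  -- fixed. The same derivative of `hR₁` gives `hK'`.
  have hQ' : ∀ p ∈ Ω, dirDeriv ![1, 1, 1] (dirDeriv ![1, 0, 0] Φ) p = 0 := by
    have h0 : ∀ᶠ w in 𝓝 w₀,
        dirDeriv ![1, 1, 1] (dirDeriv ![1, 0, 0] Φ) (upperRight φ w) = 0 := by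
      filter_upwards [eventually_deriv_eq ((H.eventually_rowDefined hΩ hw₀).mono hR₀),
        H.eventually_rowDefined hΩ hw₀] with w hd hw
      obtain ⟨x, a, a₂, m, b⟩ := w
      obtain ⟨hI, h1, h2, h3, h4⟩ := hw
      exact hd (fun r => (x, a, a₂, m, r)) b _ _ rfl (by fun_prop)
        (hasDerivAt_comp_curve (hasDerivAt_vec3
          ((((hasDerivAt_id' b).const_add a).add_const (φ x)).const_add a₂ |>.add_const (φ a))
          (((hasDerivAt_id' b).const_add a).add_const (φ x)) (hasDerivAt_id' b)) rfl (hQ _ h1))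
        (hasDerivAt_const b (dirDeriv ![1, 0, 0] Φ (lowerRight (x, a, a₂, m, b))))
    exact H.eq_zero_of_upperRight hΩc (analyticOnNhd_dirDeriv hQ _) hw₀.1.2.1 hw₀.2.1 h0
  have hK' : ∀ p ∈ Ω, dirDeriv ![1, 1, 1] (dirDeriv ![0, 0, 1] Φ) p = 0 := by
    have h0 : ∀ᶠ w in 𝓝 w₀,
        dirDeriv ![1, 1, 1] (dirDeriv ![0, 0, 1] Φ) (upperLeft φ w) = 0 := by
      filter_upwards [eventually_deriv_eq ((H.eventually_rowDefined hΩ hw₀).mono hR₁),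
        H.eventually_rowDefined hΩ hw₀] with w hd hw
      obtain ⟨x, a, a₂, m, b⟩ := w
      obtain ⟨hI, h1, h2, h3, h4⟩ := hw
      have e := hd (fun r => (x, a, a₂, m, r)) b _ _ rfl (by fun_prop)
        ((hasDerivAt_comp_curve (hasDerivAt_vec3
          (((hasDerivAt_id' b).const_add a).add_const (φ x)) (hasDerivAt_id' b)
          (((hasDerivAt_id' b).sub_const x).sub_const (φ m))) rfl (hK _ h4)).mul_const (deriv φ m))
        (hasDerivAt_const b
          (dirDeriv ![0, 0, 1] Φ (lowerLeft (x, a, a₂, m, b)) * deriv φ x))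
      exact (mul_eq_zero.1 e).resolve_right (H.deriv_ne m hI.2.2)
    obtain ⟨x, a, a₂, m, b⟩ := w₀
    obtain ⟨hI, h1, h2, h3, h4⟩ := hw₀
    have e : b - (b - x - φ m) - φ m = x := by ring
    refine eq_zero_of_eventually_comp (analyticOnNhd_dirDeriv hK _) hΩc (P := upperLeft φ)
      (S := fun p => (p 1 - p 2 - φ m, p 0 - p 1 - φ (p 1 - p 2 - φ m), a₂, m, p 1)) h4 ?_ ?_ ?_ h0
    · have e' : upperLeft φ (x, a, a₂, m, b) 1 - upperLeft φ (x, a, a₂, m, b) 2 - φ m = x := e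
      have c : ContinuousAt (fun p : Fin 3 → ℝ => φ (p 1 - p 2 - φ m))
          (upperLeft φ (x, a, a₂, m, b)) :=
        ContinuousAt.comp_of_eq (f := fun p : Fin 3 → ℝ => p 1 - p 2 - φ m)
          (H.analytic x hI.1).continuousAt (by fun_prop) e'
      exact ContinuousAt.prodMk (by fun_prop)
        (ContinuousAt.prodMk (ContinuousAt.sub (by fun_prop) c) (continuousAt_const.prodMk
          (continuousAt_const.prodMk (continuous_apply 1).continuousAt)))
    · simp [upperLeft, e]
      ring
    · refine Eventually.of_forall fun p => ?_
      ext i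
      fin_cases i <;> simp [upperLeft] <;> ring
  -- The nonvanishing of Φ_{u₋₁₀} is moved close to w₀, where all four terms are defined.
  obtain ⟨w, hwK, hw⟩ := ((frequently_ne_zero hK hΩc hne (P := lowerLeft)
    (S := fun p => (p 1, p 0, w₀.2.2.1, p 2, w₀.2.2.2.2)) hw₀.2.2.2.1 (by fun_prop) (by
      simp [lowerLeft]) (fun p => by
      ext i
      fin_cases i <;> simp [lowerLeft])).and_eventually (H.eventually_rowDefined hΩ hw₀)).exists
  have hev := H.eventually_rowDefined hΩ hw
  obtain ⟨x, a, a₂, m, b⟩ := w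
  obtain ⟨hI, h1, h2, h3, h4⟩ := hw
  obtain ⟨c1, c2, c3, c4⟩ := H.continuousAt_row hI
  -- The two functional equations live on different slices: (x, y, z) is (u₀₀, u₁₀, u₂₀) for Φ_{u₁₀}
  -- and (u₋₁₀, u₀₀, u₁₀) for Φ_{u₋₁₀}.
  have cc : ContinuousAt (fun q : ℝ × ℝ × ℝ => (q.1, q.2.1, q.2.2, m, b)) (x, a, a₂) := by fun_prop
  have cd : ContinuousAt (fun q : ℝ × ℝ × ℝ => (q.2.1, q.2.2, a₂, q.1, b)) (m, x, a) := by fun_prop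
  refine hwK (H.false_of_relations hα hlog rowDiff_section hΩ hΩc hΦ (v₀ := ![1, 0, 0])
    (v₁ := ![0, 0, 1]) (by simp [rowDiff_apply])
    (fun p hp v hv => dirDeriv_eq_zero_of_rowDiff (hQ' p hp) hv)
    (fun p hp v hv => dirDeriv_eq_zero_of_rowDiff (hK' p hp) hv)
    (P := fun q => lowerRight (q.1, q.2.1, q.2.2, m, b))
    (P' := fun q => upperRight φ (q.1, q.2.1, q.2.2, m, b))
    (R := fun q => lowerLeft (q.2.1, q.2.2, a₂, q.1, b))
    (R' := fun q => upperLeft φ (q.2.1, q.2.2, a₂, q.1, b))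
    (x₀ := x) (y₀ := a) (z₀ := a₂) (x₁ := m) (y₁ := x) (z₁ := a) hI.1 hI.2.1 hI.2.2 hI.1
    (c2.comp_of_eq cc rfl) (c1.comp_of_eq cc rfl) h2 h1 ?_ ?_
    (cc.eventually (hev.mono hR₀)) (c3.comp_of_eq cd rfl) (c4.comp_of_eq cd rfl) h3 h4 ?_ ?_
    (cd.eventually (hev.mono hR₁)))
  · intro q; simp [rowDiff_apply, lowerRight]
  · intro q
    rw [rowDiff_apply]
    ext <;> simp [upperRight] <;> ring
  · intro q; simp [rowDiff_apply, lowerLeft]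
  · intro q
    rw [rowDiff_apply]
    ext <;> simp [upperLeft] <;> ring

/-! ### Five-point symmetries

In this section `w = (u₀₀, u₁₀, u₂₀, u₋₁₀, u₀₁, u₀₂, u₀₋₁)`. -/

/-- The differences of consecutive entries of `u₁₀, u₀₀, u₋₁₀`, as a function of
`(u₁₀, u₋₁₀, u₀₀, u₀₁, u₀₋₁)`. -/
noncomputable def crossDiff : (Fin 5 → ℝ) →L[ℝ] ℝ × ℝ :=
  ContinuousLinearMap.prod (coord 0 - coord 2) (coord 2 - coord 1)

theorem crossDiff_apply (v : Fin 5 → ℝ) : crossDiff v = (v 0 - v 2, v 2 - v 1) := rfl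

/-- A section of `crossDiff`. -/
noncomputable def crossDiffSection : ℝ × ℝ →L[ℝ] (Fin 5 → ℝ) :=
  ContinuousLinearMap.pi ![ContinuousLinearMap.fst ℝ ℝ ℝ + ContinuousLinearMap.snd ℝ ℝ ℝ, 0,
    ContinuousLinearMap.snd ℝ ℝ ℝ, 0, 0]

theorem crossDiff_section (v : ℝ × ℝ) : crossDiff (crossDiffSection v) = v := by
  simp [crossDiff_apply, crossDiffSection]

theorem dirDeriv_eq_zero_of_crossDiff {f : (Fin 5 → ℝ) → ℝ} {p v : Fin 5 → ℝ}
    (h : dirDeriv ![1, 1, 1, 0, 0] f p = 0) (h₃ : dirDeriv ![0, 0, 0, 1, 0] f p = 0)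
    (h₄ : dirDeriv ![0, 0, 0, 0, 1] f p = 0) (hv : crossDiff v = 0) : dirDeriv v f p = 0 := by
  rw [crossDiff_apply, Prod.mk_eq_zero] at hv
  have : v = v 0 • ![1, 1, 1, 0, 0] + v 3 • ![0, 0, 0, 1, 0] + v 4 • ![0, 0, 0, 0, 1] := by
    ext i
    fin_cases i <;> simp <;> linarith
  unfold dirDeriv at h h₃ h₄ ⊢
  rw [this, map_add, map_add, map_smul, map_smul, map_smul, h, h₃, h₄]
  simp

theorem hasDerivAt_vec5 {a b c d e : ℝ → ℝ} {a' b' c' d' e' s : ℝ} (ha : HasDerivAt a a' s)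
    (hb : HasDerivAt b b' s) (hc : HasDerivAt c c' s) (hd : HasDerivAt d d' s)
    (he : HasDerivAt e e' s) :
    HasDerivAt (fun r => ![a r, b r, c r, d r, e r]) ![a', b', c', d', e'] s := by
  refine hasDerivAt_pi.2 fun i => ?_
  fin_cases i <;> simpa

theorem continuousAt_vec5 {W : Type*} [TopologicalSpace W] {a b c d e : W → ℝ} {w : W}
    (ha : ContinuousAt a w) (hb : ContinuousAt b w) (hc : ContinuousAt c w)
    (hd : ContinuousAt d w) (he : ContinuousAt e w) :
    ContinuousAt (fun r => ![a r, b r, c r, d r, e r]) w := by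
  refine continuousAt_pi.2 fun i => ?_
  fin_cases i <;> simpa

theorem continuousAt_tuple7 {W : Type*} [TopologicalSpace W] {a b c d e f g : W → ℝ} {w : W}
    (ha : ContinuousAt a w) (hb : ContinuousAt b w) (hc : ContinuousAt c w)
    (hd : ContinuousAt d w) (he : ContinuousAt e w) (hf : ContinuousAt f w)
    (hg : ContinuousAt g w) :
    ContinuousAt (fun r => (a r, b r, c r, d r, e r, f r, g r)) w :=
  ha.prodMk (hb.prodMk (hc.prodMk (hd.prodMk (he.prodMk (hf.prodMk hg)))))

/-- The variables of `g₁₁`. -/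
def crossUpperRight (φ : ℝ → ℝ) (w : ℝ × ℝ × ℝ × ℝ × ℝ × ℝ × ℝ) : Fin 5 → ℝ :=
  ![w.2.2.1 + (w.2.1 + w.2.2.2.2.1 + φ w.1) + φ w.2.1, w.2.2.2.2.1, w.2.1 + w.2.2.2.2.1 + φ w.1,
    w.2.1 + w.2.2.2.2.1 + φ w.1 + w.2.2.2.2.2.1 + φ w.2.2.2.2.1, w.2.1]

/-- The variables of `g₁₀`. -/
def crossLowerRight (φ : ℝ → ℝ) (w : ℝ × ℝ × ℝ × ℝ × ℝ × ℝ × ℝ) : Fin 5 → ℝ :=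
  ![w.2.2.1, w.1, w.2.1, w.2.1 + w.2.2.2.2.1 + φ w.1, w.2.1 - w.1 - φ w.2.2.2.2.2.2]

/-- The variables of `g₀₀`. -/
def crossLowerLeft (w : ℝ × ℝ × ℝ × ℝ × ℝ × ℝ × ℝ) : Fin 5 → ℝ :=
  ![w.2.1, w.2.2.2.1, w.1, w.2.2.2.2.1, w.2.2.2.2.2.2]

/-- The variables of `g₀₁`. -/
def crossUpperLeft (φ : ℝ → ℝ) (w : ℝ × ℝ × ℝ × ℝ × ℝ × ℝ × ℝ) : Fin 5 → ℝ :=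
  ![w.2.1 + w.2.2.2.2.1 + φ w.1, w.2.2.2.2.1 - w.1 - φ w.2.2.2.1, w.2.2.2.2.1, w.2.2.2.2.2.1, w.1]

/-- The conditions under which the terms of the compatibility condition are defined. -/
def CrossDefined (φ : ℝ → ℝ) (I : Set ℝ) (Ω : Set (Fin 5 → ℝ))
    (w : ℝ × ℝ × ℝ × ℝ × ℝ × ℝ × ℝ) : Prop :=
  (w.1 ∈ I ∧ w.2.1 ∈ I ∧ w.2.2.2.1 ∈ I ∧ w.2.2.2.2.1 ∈ I ∧ w.2.2.2.2.2.2 ∈ I) ∧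
    crossUpperRight φ w ∈ Ω ∧ crossLowerRight φ w ∈ Ω ∧ crossLowerLeft w ∈ Ω ∧
      crossUpperLeft φ w ∈ Ω

theorem Admissible.continuousAt_cross (H : Admissible φ I) {w : ℝ × ℝ × ℝ × ℝ × ℝ × ℝ × ℝ}
    (h : w.1 ∈ I ∧ w.2.1 ∈ I ∧ w.2.2.2.1 ∈ I ∧ w.2.2.2.2.1 ∈ I ∧ w.2.2.2.2.2.2 ∈ I) :
    ContinuousAt (crossUpperRight φ) w ∧ ContinuousAt (crossLowerRight φ) w ∧
      ContinuousAt crossLowerLeft w ∧ ContinuousAt (crossUpperLeft φ) w := by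
  have c1 := (H.analytic _ h.1).continuousAt
  have c2 := (H.analytic _ h.2.1).continuousAt
  have c3 := (H.analytic _ h.2.2.1).continuousAt
  have c4 := (H.analytic _ h.2.2.2.1).continuousAt
  have c5 := (H.analytic _ h.2.2.2.2).continuousAt
  refine ⟨continuousAt_vec5 ?_ ?_ ?_ ?_ ?_, continuousAt_vec5 ?_ ?_ ?_ ?_ ?_,
    continuousAt_vec5 ?_ ?_ ?_ ?_ ?_, continuousAt_vec5 ?_ ?_ ?_ ?_ ?_⟩ <;> fun_prop

theorem Admissible.eventually_crossDefined (H : Admissible φ I) {Ω : Set (Fin 5 → ℝ)}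
    (hΩ : IsOpen Ω) {w : ℝ × ℝ × ℝ × ℝ × ℝ × ℝ × ℝ} (h : CrossDefined φ I Ω w) :
    ∀ᶠ w' in 𝓝 w, CrossDefined φ I Ω w' := by
  obtain ⟨hI, h1, h2, h3, h4⟩ := h
  obtain ⟨c1, c2, c3, c4⟩ := H.continuousAt_cross hI
  have e : ∀ f : ℝ × ℝ × ℝ × ℝ × ℝ × ℝ × ℝ → ℝ, ContinuousAt f w → f w ∈ I →
      ∀ᶠ w' in 𝓝 w, f w' ∈ I := fun f hf hw => hf.eventually_mem (H.isOpen.mem_nhds hw)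
  filter_upwards [e (fun w => w.1) (by fun_prop) hI.1, e (fun w => w.2.1) (by fun_prop) hI.2.1,
    e (fun w => w.2.2.2.1) (by fun_prop) hI.2.2.1, e (fun w => w.2.2.2.2.1) (by fun_prop) hI.2.2.2.1,
    e (fun w => w.2.2.2.2.2.2) (by fun_prop) hI.2.2.2.2, c1.eventually_mem (hΩ.mem_nhds h1),
    c2.eventually_mem (hΩ.mem_nhds h2), c3.eventually_mem (hΩ.mem_nhds h3),
    c4.eventually_mem (hΩ.mem_nhds h4)] with w' a1 a2 a3 a4 a5 b1 b2 b3 b4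
  exact ⟨⟨a1, a2, a3, a4, a5⟩, b1, b2, b3, b4⟩

/-! ### Local sections of the four argument maps -/

section Openness

variable {f : (Fin 5 → ℝ) → ℝ} {Ω : Set (Fin 5 → ℝ)} {w₀ : ℝ × ℝ × ℝ × ℝ × ℝ × ℝ × ℝ}

/-- The arguments of g₁₁ are locally independent: u₁₁ - u₁₀ - u₀₁ = φ(u₀₀) can be solved for u₀₀
because φ' ≠ 0, and the remaining variables enter linearly. -/
theorem Admissible.eq_zero_of_crossUpperRight (H : Admissible φ I) (hΩc : IsPreconnected Ω)
    (hf : AnalyticOnNhd ℝ f Ω) (hw₀ : CrossDefined φ I Ω w₀)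
    (h : ∀ᶠ w in 𝓝 w₀, f (crossUpperRight φ w) = 0) : ∀ p ∈ Ω, f p = 0 := by
  obtain ⟨x, a, a₂, m, b, b₂, n⟩ := w₀
  obtain ⟨hI, h1, -⟩ := hw₀
  obtain ⟨ψ, hψc, hψ, hψr⟩ := exists_local_right_inverse (H.analytic x hI.1) (H.deriv_ne x hI.1)
  set q := crossUpperRight φ (x, a, a₂, m, b, b₂, n) with hq
  have q1 : q 1 = b := rfl
  have q4 : q 4 = a := rfl
  have e : q 2 - q 4 - q 1 = φ x := show a + b + φ x - a - b = φ x by ring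
  have cl : ContinuousAt (fun p : Fin 5 → ℝ => p 2 - p 4 - p 1) q := by fun_prop
  have c1 : ContinuousAt (fun p : Fin 5 → ℝ => ψ (p 2 - p 4 - p 1)) q :=
    ContinuousAt.comp_of_eq (f := fun p : Fin 5 → ℝ => p 2 - p 4 - p 1) hψc cl e
  have c2 : ContinuousAt (fun p : Fin 5 → ℝ => φ (p 4)) q :=
    ContinuousAt.comp_of_eq (f := fun p : Fin 5 → ℝ => p 4) (H.analytic a hI.2.1).continuousAt
      (continuousAt_apply _ _) q4
  have c3 : ContinuousAt (fun p : Fin 5 → ℝ => φ (p 1)) q :=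
    ContinuousAt.comp_of_eq (f := fun p : Fin 5 → ℝ => p 1)
      (H.analytic b hI.2.2.2.1).continuousAt (continuousAt_apply _ _) q1
  refine eq_zero_of_eventually_comp hf hΩc (P := crossUpperRight φ)
    (S := fun p => (ψ (p 2 - p 4 - p 1), p 4, p 0 - p 2 - φ (p 4), m, p 1,
      p 3 - p 2 - φ (p 1), n)) h1 ?_ ?_ ?_ h
  · refine continuousAt_tuple7 c1 ?_ (ContinuousAt.sub ?_ c2) ?_ ?_ (ContinuousAt.sub ?_ c3) ?_ <;>
      first | exact continuousAt_apply _ _ | fun_prop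
  · rw [← hq, e, hψ, q1, q4]
    simp [hq, crossUpperRight]
    constructor <;> ring
  · have e' : ∀ᶠ p in 𝓝 q, φ (ψ (p 2 - p 4 - p 1)) = p 2 - p 4 - p 1 := by
      rw [← e] at hψr
      exact cl.eventually hψr
    filter_upwards [e'] with p hp
    ext i
    fin_cases i <;> simp [crossUpperRight, hp] <;> ring

/-- Here u₁₀ - u₀₀ - u₁₋₁ = φ(u₀₋₁) is solved for u₀₋₁. -/
theorem Admissible.eq_zero_of_crossLowerRight (H : Admissible φ I) (hΩc : IsPreconnected Ω)
    (hf : AnalyticOnNhd ℝ f Ω) (hw₀ : CrossDefined φ I Ω w₀)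
    (h : ∀ᶠ w in 𝓝 w₀, f (crossLowerRight φ w) = 0) : ∀ p ∈ Ω, f p = 0 := by
  obtain ⟨x, a, a₂, m, b, b₂, n⟩ := w₀
  obtain ⟨hI, -, h1, -⟩ := hw₀
  obtain ⟨ψ, hψc, hψ, hψr⟩ := exists_local_right_inverse (H.analytic n hI.2.2.2.2)
    (H.deriv_ne n hI.2.2.2.2)
  set q := crossLowerRight φ (x, a, a₂, m, b, b₂, n) with hq
  have q1 : q 1 = x := rfl
  have e : q 2 - q 1 - q 4 = φ n := show a - x - (a - x - φ n) = φ n by ring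
  have cl : ContinuousAt (fun p : Fin 5 → ℝ => p 2 - p 1 - p 4) q := by fun_prop
  have c1 : ContinuousAt (fun p : Fin 5 → ℝ => ψ (p 2 - p 1 - p 4)) q :=
    ContinuousAt.comp_of_eq (f := fun p : Fin 5 → ℝ => p 2 - p 1 - p 4) hψc cl e
  have c2 : ContinuousAt (fun p : Fin 5 → ℝ => φ (p 1)) q :=
    ContinuousAt.comp_of_eq (f := fun p : Fin 5 → ℝ => p 1) (H.analytic x hI.1).continuousAt
      (continuousAt_apply _ _) q1
  refine eq_zero_of_eventually_comp hf hΩc (P := crossLowerRight φ)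
    (S := fun p => (p 1, p 2, p 0, m, p 3 - p 2 - φ (p 1), b₂, ψ (p 2 - p 1 - p 4))) h1 ?_ ?_ ?_ h
  · refine continuousAt_tuple7 ?_ ?_ ?_ ?_ (ContinuousAt.sub ?_ c2) ?_ c1 <;>
      first | exact continuousAt_apply _ _ | fun_prop
  · rw [← hq, e, hψ, q1]
    simp [hq, crossLowerRight]
    ring
  · have e' : ∀ᶠ p in 𝓝 q, φ (ψ (p 2 - p 1 - p 4)) = p 2 - p 1 - p 4 := by
      rw [← e] at hψr
      exact cl.eventually hψr
    filter_upwards [e'] with p hp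
    ext i
    fin_cases i <;> simp [crossLowerRight, hp]
    ring

/-- Here u₀₁ - u₀₀ - u₋₁₁ = φ(u₋₁₀) is solved for u₋₁₀. -/
theorem Admissible.eq_zero_of_crossUpperLeft (H : Admissible φ I) (hΩc : IsPreconnected Ω)
    (hf : AnalyticOnNhd ℝ f Ω) (hw₀ : CrossDefined φ I Ω w₀)
    (h : ∀ᶠ w in 𝓝 w₀, f (crossUpperLeft φ w) = 0) : ∀ p ∈ Ω, f p = 0 := by
  obtain ⟨x, a, a₂, m, b, b₂, n⟩ := w₀
  obtain ⟨hI, -, -, -, h1⟩ := hw₀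
  obtain ⟨ψ, hψc, hψ, hψr⟩ := exists_local_right_inverse (H.analytic m hI.2.2.1)
    (H.deriv_ne m hI.2.2.1)
  set q := crossUpperLeft φ (x, a, a₂, m, b, b₂, n) with hq
  have q4 : q 4 = x := rfl
  have e : q 2 - q 4 - q 1 = φ m := show b - x - (b - x - φ m) = φ m by ring
  have cl : ContinuousAt (fun p : Fin 5 → ℝ => p 2 - p 4 - p 1) q := by fun_prop
  have c1 : ContinuousAt (fun p : Fin 5 → ℝ => ψ (p 2 - p 4 - p 1)) q :=
    ContinuousAt.comp_of_eq (f := fun p : Fin 5 → ℝ => p 2 - p 4 - p 1) hψc cl e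
  have c2 : ContinuousAt (fun p : Fin 5 → ℝ => φ (p 4)) q :=
    ContinuousAt.comp_of_eq (f := fun p : Fin 5 → ℝ => p 4) (H.analytic x hI.1).continuousAt
      (continuousAt_apply _ _) q4
  refine eq_zero_of_eventually_comp hf hΩc (P := crossUpperLeft φ)
    (S := fun p => (p 4, p 0 - p 2 - φ (p 4), a₂, ψ (p 2 - p 4 - p 1), p 2, p 3, n)) h1 ?_ ?_ ?_ h
  · refine continuousAt_tuple7 ?_ (ContinuousAt.sub ?_ c2) ?_ c1 ?_ ?_ ?_ <;>
      first | exact continuousAt_apply _ _ | fun_prop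
  · rw [← hq, e, hψ, q4]
    simp [hq, crossUpperLeft]
    ring
  · have e' : ∀ᶠ p in 𝓝 q, φ (ψ (p 2 - p 4 - p 1)) = p 2 - p 4 - p 1 := by
      rw [← e] at hψr
      exact cl.eventually hψr
    filter_upwards [e'] with p hp
    ext i
    fin_cases i <;> simp [crossUpperLeft, hp]
    ring

theorem eq_zero_of_crossLowerLeft (hΩc : IsPreconnected Ω)
    (hf : AnalyticOnNhd ℝ f Ω) (hw₀ : CrossDefined φ I Ω w₀)
    (h : ∀ᶠ w in 𝓝 w₀, f (crossLowerLeft w) = 0) : ∀ p ∈ Ω, f p = 0 := by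
  by_contra! hne
  refine frequently_ne_zero hf hΩc hne (P := crossLowerLeft)
    (S := fun p => (p 2, p 0, w₀.2.2.1, p 1, p 3, w₀.2.2.2.2.2.1, p 4)) hw₀.2.2.2.1 (by fun_prop) ?_
    (fun p => ?_) (h.mono fun w hw => not_not.2 hw)
  · simp [crossLowerLeft]
  · ext i
    fin_cases i <;> simp [crossLowerLeft]

end Openness

/-- A function `G (u₁₀, u₋₁₀, u₀₀, u₀₁, u₀₋₁)` that satisfies the compatibility condition does not
depend on `u₋₁₀`. -/
theorem Admissible.cross_symmetry (H : Admissible φ I) {α γ : ℝ} (hα : α ≠ 0)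
    (hlog : ∀ z ∈ I, Real.log (deriv φ z) = α * (φ z + z) + γ) {Ω : Set (Fin 5 → ℝ)}
    (hΩ : IsOpen Ω) (hΩc : IsPreconnected Ω) {G : (Fin 5 → ℝ) → ℝ} (hG : AnalyticOnNhd ℝ G Ω)
    (hex : ∃ w, CrossDefined φ I Ω w)
    (hsym : ∀ w, CrossDefined φ I Ω w →
      G (crossUpperRight φ w) = G (crossLowerRight φ w) + G (crossLowerLeft w) * deriv φ w.1 +
        G (crossUpperLeft φ w)) :
    ∀ p ∈ Ω, dirDeriv ![0, 1, 0, 0, 0] G p = 0 := by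
  by_contra! hne
  obtain ⟨w₀, hw₀⟩ := hex
  have hQ := analyticOnNhd_dirDeriv hG ![1, 0, 0, 0, 0]
  have hK := analyticOnNhd_dirDeriv hG ![0, 1, 0, 0, 0]
  have smul_dir : ∀ (f : (Fin 5 → ℝ) → ℝ) (p v : Fin 5 → ℝ) (c : ℝ),
      dirDeriv (c • v) f p = c * dirDeriv v f p := fun f p v c => by
    unfold dirDeriv
    rw [map_smul, smul_eq_mul]
  have hrel : ∀ w, CrossDefined φ I Ω w → ∀ᶠ w' in 𝓝 w, G (crossUpperRight φ w') =
      G (crossLowerRight φ w') + G (crossLowerLeft w') * deriv φ w'.1 + G (crossUpperLeft φ w') :=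
    fun w hw => (H.eventually_crossDefined hΩ hw).mono hsym
  have hR₀ : ∀ w, CrossDefined φ I Ω w → dirDeriv ![1, 0, 0, 0, 0] G (crossUpperRight φ w) =
      dirDeriv ![1, 0, 0, 0, 0] G (crossLowerRight φ w) := by
    intro w hw
    have hd := (eventually_deriv_eq (hrel w hw)).self_of_nhds
    obtain ⟨x, a, a₂, m, b, b₂, n⟩ := w
    obtain ⟨hI, h1, h2, h3, h4⟩ := hw
    exact hd (fun r => (x, a, r, m, b, b₂, n)) a₂ _ _ rfl (by fun_prop)
      (hasDerivAt_comp_curve (hasDerivAt_vec5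
        (((hasDerivAt_id' a₂).add_const (a + b + φ x)).add_const (φ a)) (hasDerivAt_const a₂ b)
        (hasDerivAt_const a₂ (a + b + φ x)) (hasDerivAt_const a₂ (a + b + φ x + b₂ + φ b))
        (hasDerivAt_const a₂ a)) rfl (hG _ h1))
      (((hasDerivAt_comp_curve (hasDerivAt_vec5 (hasDerivAt_id' a₂) (hasDerivAt_const a₂ x)
        (hasDerivAt_const a₂ a) (hasDerivAt_const a₂ (a + b + φ x))
        (hasDerivAt_const a₂ (a - x - φ n))) rfl (hG _ h2)).add_const
          (G (crossLowerLeft (x, a, a₂, m, b, b₂, n)) * deriv φ x)).add_const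
          (G (crossUpperLeft φ (x, a, a₂, m, b, b₂, n))))
  have hR₁ : ∀ w, CrossDefined φ I Ω w →
      dirDeriv ![0, 1, 0, 0, 0] G (crossUpperLeft φ w) * deriv φ w.2.2.2.1 =
        dirDeriv ![0, 1, 0, 0, 0] G (crossLowerLeft w) * deriv φ w.1 := by
    intro w hw
    have hd := (eventually_deriv_eq (hrel w hw)).self_of_nhds
    obtain ⟨x, a, a₂, m, b, b₂, n⟩ := w
    obtain ⟨hI, h1, h2, h3, h4⟩ := hw
    have e := hd (fun r => (x, a, a₂, r, b, b₂, n)) m _ _ rfl (by fun_prop)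
      (hasDerivAt_const m (G (crossUpperRight φ (x, a, a₂, m, b, b₂, n))))
      ((((hasDerivAt_comp_curve (hasDerivAt_vec5 (hasDerivAt_const m a) (hasDerivAt_id' m)
        (hasDerivAt_const m x) (hasDerivAt_const m b) (hasDerivAt_const m n))
        rfl (hG _ h3)).mul_const (deriv φ x)).const_add
          (G (crossLowerRight φ (x, a, a₂, m, b, b₂, n)))).add
        (hasDerivAt_comp_curve (hasDerivAt_vec5 (hasDerivAt_const m (a + b + φ x))
          ((H.analytic m hI.2.2.1).differentiableAt.hasDerivAt.const_sub (b - x))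
          (hasDerivAt_const m b) (hasDerivAt_const m b₂) (hasDerivAt_const m x)) rfl (hG _ h4)))
    have e1 : (![0, -deriv φ m, 0, 0, 0] : Fin 5 → ℝ) = (-deriv φ m) • ![0, 1, 0, 0, 0] := by simp
    rw [e1, smul_dir] at e
    change 0 = dirDeriv ![0, 1, 0, 0, 0] G (crossLowerLeft (x, a, a₂, m, b, b₂, n)) *
      deriv φ x + _ at e
    simp only
    linarith
  have hev := H.eventually_crossDefined hΩ hw₀
  -- In `hR₀` the variable u₀₋₁ enters only the arguments of g₁₀, and u₀₂ only those of g₁₁, so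
  -- G_{u₁₀} depends on neither vertical neighbour.
  have hQ₄ : ∀ p ∈ Ω, dirDeriv ![0, 0, 0, 0, 1] (dirDeriv ![1, 0, 0, 0, 0] G) p = 0 := by
    refine H.eq_zero_of_crossLowerRight hΩc (analyticOnNhd_dirDeriv hQ _) hw₀ ?_
    filter_upwards [eventually_deriv_eq (hev.mono hR₀), hev] with w hd hw
    obtain ⟨x, a, a₂, m, b, b₂, n⟩ := w
    obtain ⟨hI, h1, h2, h3, h4⟩ := hw
    have e := hd (fun r => (x, a, a₂, m, b, b₂, r)) n _ _ rfl (by fun_prop)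
      (hasDerivAt_const n
        (dirDeriv ![1, 0, 0, 0, 0] G (crossUpperRight φ (x, a, a₂, m, b, b₂, n))))
      (hasDerivAt_comp_curve (hasDerivAt_vec5 (hasDerivAt_const n a₂) (hasDerivAt_const n x)
        (hasDerivAt_const n a) (hasDerivAt_const n (a + b + φ x))
        ((H.analytic n hI.2.2.2.2).differentiableAt.hasDerivAt.const_sub (a - x))) rfl (hQ _ h2))
    have e1 : (![0, 0, 0, 0, -deriv φ n] : Fin 5 → ℝ) = (-deriv φ n) • ![0, 0, 0, 0, 1] := by simp
    rw [e1, smul_dir] at e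
    exact (mul_eq_zero.1 e.symm).resolve_left (neg_ne_zero.2 (H.deriv_ne n hI.2.2.2.2))
  have hQ₃ : ∀ p ∈ Ω, dirDeriv ![0, 0, 0, 1, 0] (dirDeriv ![1, 0, 0, 0, 0] G) p = 0 := by
    refine H.eq_zero_of_crossUpperRight hΩc (analyticOnNhd_dirDeriv hQ _) hw₀ ?_
    filter_upwards [eventually_deriv_eq (hev.mono hR₀), hev] with w hd hw
    obtain ⟨x, a, a₂, m, b, b₂, n⟩ := w
    obtain ⟨hI, h1, h2, h3, h4⟩ := hw
    exact hd (fun r => (x, a, a₂, m, b, r, n)) b₂ _ _ rfl (by fun_prop)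
      (hasDerivAt_comp_curve (hasDerivAt_vec5
        (hasDerivAt_const b₂ (a₂ + (a + b + φ x) + φ a)) (hasDerivAt_const b₂ b)
        (hasDerivAt_const b₂ (a + b + φ x))
        (((hasDerivAt_id' b₂).const_add (a + b + φ x)).add_const (φ b))
        (hasDerivAt_const b₂ a)) rfl (hQ _ h1))
      (hasDerivAt_const b₂
        (dirDeriv ![1, 0, 0, 0, 0] G (crossLowerRight φ (x, a, a₂, m, b, b₂, n))))
  -- Varying u₀₁ also moves the vertical neighbour in both argument lists, but `hQ₃` removes those
  -- contributions.
  have hQ₁ : ∀ p ∈ Ω, dirDeriv ![1, 1, 1, 0, 0] (dirDeriv ![1, 0, 0, 0, 0] G) p = 0 := by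
    refine H.eq_zero_of_crossUpperRight hΩc (analyticOnNhd_dirDeriv hQ _) hw₀ ?_
    filter_upwards [eventually_deriv_eq (hev.mono hR₀), hev] with w hd hw
    obtain ⟨x, a, a₂, m, b, b₂, n⟩ := w
    obtain ⟨hI, h1, h2, h3, h4⟩ := hw
    have dc := ((hasDerivAt_id' b).const_add a).add_const (φ x)
    have e := hd (fun r => (x, a, a₂, m, r, b₂, n)) b _ _ rfl (by fun_prop)
      (hasDerivAt_comp_curve (hasDerivAt_vec5 ((dc.const_add a₂).add_const (φ a))
        (hasDerivAt_id' b) dc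
        ((dc.add_const b₂).add (H.analytic b hI.2.2.2.1).differentiableAt.hasDerivAt)
        (hasDerivAt_const b a)) rfl (hQ _ h1))
      (hasDerivAt_comp_curve (hasDerivAt_vec5 (hasDerivAt_const b a₂) (hasDerivAt_const b x)
        (hasDerivAt_const b a) dc (hasDerivAt_const b (a - x - φ n))) rfl (hQ _ h2))
    have e1 : (![1, 1, 1, 1 + deriv φ b, 0] : Fin 5 → ℝ) =
        ![1, 1, 1, 0, 0] + (1 + deriv φ b) • ![0, 0, 0, 1, 0] := by simp
    have e2 : ∀ p ∈ Ω, dirDeriv ![1, 1, 1, 1 + deriv φ b, 0] (dirDeriv ![1, 0, 0, 0, 0] G) p =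
        dirDeriv ![1, 1, 1, 0, 0] (dirDeriv ![1, 0, 0, 0, 0] G) p := by
      intro p hp
      have := hQ₃ p hp
      unfold dirDeriv at this ⊢
      rw [e1, map_add, map_smul, this, smul_zero, add_zero]
    rw [← e2 _ h1]
    exact e.trans (hQ₃ _ h2)
  have hK₃ : ∀ p ∈ Ω, dirDeriv ![0, 0, 0, 1, 0] (dirDeriv ![0, 1, 0, 0, 0] G) p = 0 := by
    refine H.eq_zero_of_crossUpperLeft hΩc (analyticOnNhd_dirDeriv hK _) hw₀ ?_
    filter_upwards [eventually_deriv_eq (hev.mono hR₁), hev] with w hd hw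
    obtain ⟨x, a, a₂, m, b, b₂, n⟩ := w
    obtain ⟨hI, h1, h2, h3, h4⟩ := hw
    have e := hd (fun r => (x, a, a₂, m, b, r, n)) b₂ _ _ rfl (by fun_prop)
      ((hasDerivAt_comp_curve (hasDerivAt_vec5 (hasDerivAt_const b₂ (a + b + φ x))
        (hasDerivAt_const b₂ (b - x - φ m)) (hasDerivAt_const b₂ b) (hasDerivAt_id' b₂)
        (hasDerivAt_const b₂ x)) rfl (hK _ h4)).mul_const (deriv φ m))
      (hasDerivAt_const b₂
        (dirDeriv ![0, 1, 0, 0, 0] G (crossLowerLeft (x, a, a₂, m, b, b₂, n)) * deriv φ x))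
    exact (mul_eq_zero.1 e).resolve_right (H.deriv_ne m hI.2.2.1)
  have hK₄ : ∀ p ∈ Ω, dirDeriv ![0, 0, 0, 0, 1] (dirDeriv ![0, 1, 0, 0, 0] G) p = 0 := by
    refine eq_zero_of_crossLowerLeft hΩc (analyticOnNhd_dirDeriv hK _) hw₀ ?_
    filter_upwards [eventually_deriv_eq (hev.mono hR₁), hev] with w hd hw
    obtain ⟨x, a, a₂, m, b, b₂, n⟩ := w
    obtain ⟨hI, h1, h2, h3, h4⟩ := hw
    have e := hd (fun r => (x, a, a₂, m, b, b₂, r)) n _ _ rfl (by fun_prop)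
      (hasDerivAt_const n
        (dirDeriv ![0, 1, 0, 0, 0] G (crossUpperLeft φ (x, a, a₂, m, b, b₂, n)) * deriv φ m))
      ((hasDerivAt_comp_curve (hasDerivAt_vec5 (hasDerivAt_const n a) (hasDerivAt_const n m)
        (hasDerivAt_const n x) (hasDerivAt_const n b) (hasDerivAt_id' n))
        rfl (hK _ h3)).mul_const (deriv φ x))
    exact (mul_eq_zero.1 e.symm).resolve_right (H.deriv_ne x hI.1)
  -- In the arguments of g₀₀ the variable u₀₁ is the vertical neighbour, so `hK₃` makes the
  -- right-hand derivative zero.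
  have hK₁ : ∀ p ∈ Ω, dirDeriv ![1, 1, 1, 0, 0] (dirDeriv ![0, 1, 0, 0, 0] G) p = 0 := by
    refine H.eq_zero_of_crossUpperLeft hΩc (analyticOnNhd_dirDeriv hK _) hw₀ ?_
    filter_upwards [eventually_deriv_eq (hev.mono hR₁), hev] with w hd hw
    obtain ⟨x, a, a₂, m, b, b₂, n⟩ := w
    obtain ⟨hI, h1, h2, h3, h4⟩ := hw
    have e := hd (fun r => (x, a, a₂, m, r, b₂, n)) b _ _ rfl (by fun_prop)
      ((hasDerivAt_comp_curve (hasDerivAt_vec5 (((hasDerivAt_id' b).const_add a).add_const (φ x))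
        (((hasDerivAt_id' b).sub_const x).sub_const (φ m)) (hasDerivAt_id' b)
        (hasDerivAt_const b b₂) (hasDerivAt_const b x)) rfl (hK _ h4)).mul_const (deriv φ m))
      ((hasDerivAt_comp_curve (hasDerivAt_vec5 (hasDerivAt_const b a) (hasDerivAt_const b m)
        (hasDerivAt_const b x) (hasDerivAt_id' b) (hasDerivAt_const b n))
        rfl (hK _ h3)).mul_const (deriv φ x))
    have e3 := hK₃ _ h3
    change _ = dirDeriv ![0, 0, 0, 1, 0] (dirDeriv ![0, 1, 0, 0, 0] G)
      (crossLowerLeft (x, a, a₂, m, b, b₂, n)) * deriv φ x at e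
    rw [e3, zero_mul] at e
    exact (mul_eq_zero.1 e).resolve_right (H.deriv_ne m hI.2.2.1)
  obtain ⟨w, hwK, hw⟩ : ∃ w, dirDeriv ![0, 1, 0, 0, 0] G (crossLowerLeft w) ≠ 0 ∧
      CrossDefined φ I Ω w := by
    by_contra! hno
    obtain ⟨p, hp, hpn⟩ := hne
    refine hpn (eq_zero_of_crossLowerLeft hΩc hK hw₀ ?_ p hp)
    filter_upwards [hev] with w hw
    by_contra h0
    exact hno w h0 hw
  have hev' := H.eventually_crossDefined hΩ hw
  obtain ⟨x, a, a₂, m, b, b₂, n⟩ := w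
  obtain ⟨hI, h1, h2, h3, h4⟩ := hw
  obtain ⟨c1, c2, c3, c4⟩ := H.continuousAt_cross hI
  have cc : ContinuousAt (fun q : ℝ × ℝ × ℝ => (q.1, q.2.1, q.2.2, m, b, b₂, n)) (x, a, a₂) := by
    fun_prop
  have cd : ContinuousAt (fun q : ℝ × ℝ × ℝ => (q.2.1, q.2.2, a₂, q.1, b, b₂, n)) (m, x, a) := by
    fun_prop
  refine hwK (H.false_of_relations hα hlog crossDiff_section hΩ hΩc hG (v₀ := ![1, 0, 0, 0, 0])
    (v₁ := ![0, 1, 0, 0, 0]) (by simp [crossDiff_apply])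
    (fun p hp v hv => dirDeriv_eq_zero_of_crossDiff (hQ₁ p hp) (hQ₃ p hp) (hQ₄ p hp) hv)
    (fun p hp v hv => dirDeriv_eq_zero_of_crossDiff (hK₁ p hp) (hK₃ p hp) (hK₄ p hp) hv)
    (P := fun q => crossLowerRight φ (q.1, q.2.1, q.2.2, m, b, b₂, n))
    (P' := fun q => crossUpperRight φ (q.1, q.2.1, q.2.2, m, b, b₂, n))
    (R := fun q => crossLowerLeft (q.2.1, q.2.2, a₂, q.1, b, b₂, n))
    (R' := fun q => crossUpperLeft φ (q.2.1, q.2.2, a₂, q.1, b, b₂, n))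
    (x₀ := x) (y₀ := a) (z₀ := a₂) (x₁ := m) (y₁ := x) (z₁ := a) hI.1 hI.2.1 hI.2.2.1 hI.1
    (c2.comp_of_eq cc rfl) (c1.comp_of_eq cc rfl) h2 h1 ?_ ?_
    (cc.eventually (hev'.mono hR₀)) (c3.comp_of_eq cd rfl) (c4.comp_of_eq cd rfl) h3 h4 ?_ ?_
    (cd.eventually (hev'.mono hR₁)))
  · intro q; simp [crossDiff_apply, crossLowerRight]
  · intro q
    rw [crossDiff_apply]
    ext <;> simp [crossUpperRight] <;> ring
  · intro q; simp [crossDiff_apply, crossLowerLeft]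
  · intro q
    rw [crossDiff_apply]
    ext <;> simp [crossUpperLeft] <;> ring

/-! ### Laws along a row -/

/-- A function `Q (u₂₀, u₁₀, u₀₀)` with `(T₂ - 1) Q = L (u₁₀) - L (u₀₀)` forces
`L' = a (1 + φ')`. -/
theorem Admissible.deriv_eq_of_row_law (H : Admissible φ I) {L : ℝ → ℝ}
    (hL : AnalyticOnNhd ℝ L I) {Ω : Set (Fin 3 → ℝ)} (hΩ : IsOpen Ω) (hΩc : IsPreconnected Ω)
    {Q : (Fin 3 → ℝ) → ℝ} (hQ : AnalyticOnNhd ℝ Q Ω) {w₀ : ℝ × ℝ × ℝ × ℝ × ℝ}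
    (hw₀ : (w₀.1 ∈ I ∧ w₀.2.1 ∈ I ∧ w₀.2.2.2.1 ∈ I) ∧ upperRight φ w₀ ∈ Ω ∧ lowerRight w₀ ∈ Ω)
    (hlaw : ∀ w : ℝ × ℝ × ℝ × ℝ × ℝ, w.1 ∈ I → w.2.1 ∈ I → upperRight φ w ∈ Ω →
      lowerRight w ∈ Ω → Q (upperRight φ w) - Q (lowerRight w) = L w.2.1 - L w.1) :
    ∃ a, ∀ x ∈ I, deriv L x = a * (1 + deriv φ x) := by
  obtain ⟨hI, h1, h2⟩ := hw₀
  obtain ⟨c1, c2, -⟩ := H.continuousAt_row hI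
  have d1 : ContinuousAt (fun w : ℝ × ℝ × ℝ × ℝ × ℝ => w.1) w₀ := by fun_prop
  have d2 : ContinuousAt (fun w : ℝ × ℝ × ℝ × ℝ × ℝ => w.2.1) w₀ := by fun_prop
  have e1 := c1.eventually_mem (hΩ.mem_nhds h1)
  have hev : ∀ᶠ w in 𝓝 w₀, Q (upperRight φ w) - Q (lowerRight w) = L w.2.1 - L w.1 := by
    filter_upwards [d1.eventually_mem (H.isOpen.mem_nhds hI.1),
      d2.eventually_mem (H.isOpen.mem_nhds hI.2.1), e1,
      c2.eventually_mem (hΩ.mem_nhds h2)] with w a1 a2 a3 a4 using hlaw w a1 a2 a3 a4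
  have hQ' : ∀ p ∈ Ω, dirDeriv ![1, 1, 1] Q p = 0 := by
    refine H.eq_zero_of_upperRight hΩc (analyticOnNhd_dirDeriv hQ _) hI.2.1 h1 ?_
    filter_upwards [eventually_deriv_eq hev, e1] with w hd hw
    obtain ⟨x, a, a₂, m, b⟩ := w
    exact hd (fun r => (x, a, a₂, m, r)) b _ _ rfl (by fun_prop)
      ((hasDerivAt_comp_curve (hasDerivAt_vec3
        ((((hasDerivAt_id' b).const_add a).add_const (φ x)).const_add a₂ |>.add_const (φ a))
        (((hasDerivAt_id' b).const_add a).add_const (φ x)) (hasDerivAt_id' b)) rfl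
          (hQ _ hw)).sub_const (Q (lowerRight (x, a, a₂, m, b))))
      (hasDerivAt_const b (L a - L x))
  obtain ⟨x, a, a₂, m, b⟩ := w₀
  have cc : ContinuousAt (fun q : ℝ × ℝ × ℝ => (q.1, q.2.1, q.2.2, m, b)) (x, a, a₂) := by fun_prop
  obtain ⟨c, hc, -⟩ := H.global_functional_equation hL rowDiff_section hΩ hΩc hQ
    (fun p hp v hv => dirDeriv_eq_zero_of_rowDiff (hQ' p hp) hv)
    (P := fun q => lowerRight (q.1, q.2.1, q.2.2, m, b))
    (P' := fun q => upperRight φ (q.1, q.2.1, q.2.2, m, b))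
    (x₀ := x) (y₀ := a) (z₀ := a₂) hI.1 hI.2.1 (c2.comp_of_eq cc rfl) (c1.comp_of_eq cc rfl) h2 h1
    (fun q => by simp [rowDiff_apply, lowerRight])
    (fun q => by
      rw [rowDiff_apply]
      ext <;> simp [upperRight] <;> ring)
    (cc.eventually hev)
  exact ⟨c, hc⟩

/-! ### The equation on the lattice -/

/-- The values of a solution near the base point in terms of
`u₀₀, u₁₀, u₂₀, u₋₁₀, u₀₁, u₀₂, u₀₋₁`. -/
noncomputable def localSolution (φ : ℝ → ℝ) (x a a₂ m b b₂ n : ℝ) : Lattice := fun i j =>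
  if i = 0 ∧ j = 0 then x else if i = 1 ∧ j = 0 then a else if i = 2 ∧ j = 0 then a₂ else
  if i = -1 ∧ j = 0 then m else if i = 0 ∧ j = 1 then b else if i = 0 ∧ j = 2 then b₂ else
  if i = 0 ∧ j = -1 then n else if i = 1 ∧ j = 1 then a + b + φ x else
  if i = 2 ∧ j = 1 then a₂ + (a + b + φ x) + φ a else if i = -1 ∧ j = 1 then b - x - φ m else
  if i = 1 ∧ j = 2 then a + b + φ x + b₂ + φ b else if i = 1 ∧ j = -1 then a - x - φ n else 0

theorem solvesOn_rhs {W : Set (ℤ × ℤ)} {u : Lattice} :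
    SolvesOn (rhs φ) (rhsDom I) W u ↔ ∀ w ∈ W, u w.1 w.2 ∈ I ∧
      u (w.1 + 1) (w.2 + 1) = u (w.1 + 1) w.2 + u w.1 (w.2 + 1) + φ (u w.1 w.2) := by
  refine forall₂_congr fun w _ => ?_
  simp [rhs, rhsDom, corner, shift, add_comm]

theorem pd_rhs {x : Fin 3 → ℝ} (h : DifferentiableAt ℝ φ (x 1)) :
    pd 0 (rhs φ) x = 1 ∧ pd 1 (rhs φ) x = deriv φ (x 1) ∧ pd 2 (rhs φ) x = 1 := by
  have hd : HasFDerivAt (rhs φ) (coord 0 + coord 2 + deriv φ (x 1) • coord 1) x :=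
    ((coord 0).hasFDerivAt.add (coord 2).hasFDerivAt).add
      (h.hasDerivAt.comp_hasFDerivAt x (coord (1 : Fin 3)).hasFDerivAt)
  unfold pd
  rw [hd.fderiv]
  simp [coord]

theorem pd_eq_dirDeriv {n : ℕ} (k : Fin n) (f : (Fin n → ℝ) → ℝ) (x : Fin n → ℝ) :
    pd k f x = dirDeriv (Pi.single k 1) f x := rfl

/-- Tuples w and solutions on the quads involved correspond: a solution restricts to a tuple, and
`localSolution` realises every admissible tuple. The vanishing of Φ_{u₋₁₀} alone contradicts
nondegeneracy. -/
theorem Admissible.not_row_symmetry (H : Admissible φ I) (hlog : LogDerivEq φ I) :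
    ¬ HasHorizontalSymmetry (rhs φ) (rhsDom I) := by
  rintro ⟨Ω, Φ, hΩ, hΩc, hΦ, ⟨p, hp, hne⟩, ⟨u, hu, hdef⟩, hsym⟩
  obtain ⟨α, γ, hα, hlog⟩ := hlog
  apply hne
  have : (Pi.single 2 1 : Fin 3 → ℝ) = ![0, 0, 1] := by
    ext i; fin_cases i <;> simp
  rw [pd_eq_dirDeriv 2, this]
  refine mul_eq_zero_of_right _ (H.row_symmetry hα hlog hΩ hΩc.isPreconnected hΦ ?_ ?_ p hp)
  · simp only [solvesOn_rhs, mem_insert_iff, mem_singleton_iff, forall_eq_or_imp, forall_eq] at hu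
    obtain ⟨d1, d2, d3, d4⟩ := hdef
    simp only [horiz, shift, mem_ofPred_eq] at d1 d2 d3 d4
    norm_num at hu d1 d2 d3 d4
    refine ⟨(u 0 0, u 1 0, u 2 0, u (-1) 0, u 0 1), ⟨hu.1.1, hu.2.1.1, hu.2.2.1⟩, ?_⟩
    have e : u 0 1 - u 0 0 - φ (u (-1) 0) = u (-1) 1 := by linarith
    simp only [upperRight, lowerRight, lowerLeft, upperLeft, ← hu.1.2, ← hu.2.1.2, e]
    exact ⟨d4, d2, d1, d3⟩
  · rintro ⟨x, a, a₂, m, b⟩ ⟨hI, h1, h2, h3, h4⟩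
    have hs : SolvesOn (rhs φ) (rhsDom I) {(0, 0), (1, 0), (-1, 0)}
        (localSolution φ x a a₂ m b 0 0) := by
      simp only [solvesOn_rhs, mem_insert_iff, mem_singleton_iff, forall_eq_or_imp, forall_eq]
      simp only [localSolution]
      norm_num
      exact ⟨hI.1, hI.2.1, hI.2.2, by ring⟩
    have := hsym (localSolution φ x a a₂ m b 0 0) hs (by
      refine ⟨?_, ?_, ?_, ?_⟩
      · simpa [horiz, shift, localSolution, lowerLeft] using h3
      · simpa [horiz, shift, localSolution, lowerRight] using h2
      · simpa [horiz, shift, localSolution, upperLeft] using h4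
      · simpa [horiz, shift, localSolution, upperRight] using h1)
    obtain ⟨e0, e1, e2⟩ := pd_rhs (φ := φ) (x := corner (localSolution φ x a a₂ m b 0 0)) (by
      simpa [corner, localSolution] using (H.analytic x hI.1).differentiableAt)
    rw [e0, e1, e2] at this
    simpa [horiz, shift, localSolution, corner, upperRight, lowerRight, lowerLeft, upperLeft]
      using this

theorem Admissible.not_col_symmetry (H : Admissible φ I) (hlog : LogDerivEq φ I) :
    ¬ HasVerticalSymmetry (rhs φ) (rhsDom I) := by
  rintro ⟨Ω, Ψ, hΩ, hΩc, hΨ, ⟨p, hp, hne⟩, ⟨u, hu, hdef⟩, hsym⟩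
  obtain ⟨α, γ, hα, hlog⟩ := hlog
  apply hne
  have : (Pi.single 2 1 : Fin 3 → ℝ) = ![0, 0, 1] := by
    ext i; fin_cases i <;> simp
  rw [pd_eq_dirDeriv 2, this]
  refine mul_eq_zero_of_right _ (H.row_symmetry hα hlog hΩ hΩc.isPreconnected hΨ ?_ ?_ p hp)
  · simp only [solvesOn_rhs, mem_insert_iff, mem_singleton_iff, forall_eq_or_imp, forall_eq] at hu
    obtain ⟨d1, d2, d3, d4⟩ := hdef
    simp only [vert, shift, mem_ofPred_eq] at d1 d2 d3 d4
    norm_num at hu d1 d2 d3 d4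
    refine ⟨(u 0 0, u 0 1, u 0 2, u 0 (-1), u 1 0), ⟨hu.1.1, hu.2.1.1, hu.2.2.1⟩, ?_⟩
    have e : u 1 0 - u 0 0 - φ (u 0 (-1)) = u 1 (-1) := by linarith
    have e1 : u 0 1 + u 1 0 + φ (u 0 0) = u 1 1 := by linarith
    have e2 : u 0 2 + u 1 1 + φ (u 0 1) = u 1 2 := by linarith
    simp only [upperRight, lowerRight, lowerLeft, upperLeft, e, e1, e2]
    exact ⟨d4, d3, d1, d2⟩
  · rintro ⟨x, a, a₂, m, b⟩ ⟨hI, h1, h2, h3, h4⟩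
    -- The equation is symmetric in the two lattice directions, so the transposed solution reduces
    -- this case to `Admissible.row_symmetry`.
    obtain ⟨u, hu⟩ : ∃ u : Lattice, u = fun i j => localSolution φ x a a₂ m b 0 0 j i := ⟨_, rfl⟩
    have hs : SolvesOn (rhs φ) (rhsDom I) {(0, 0), (0, 1), (0, -1)} u := by
      simp only [solvesOn_rhs, mem_insert_iff, mem_singleton_iff, forall_eq_or_imp, forall_eq]
      simp only [hu, localSolution]
      norm_num
      exact ⟨⟨hI.1, by ring⟩, ⟨hI.2.1, by ring⟩, hI.2.2, by ring⟩
    have := hsym u hs (by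
      refine ⟨?_, ?_, ?_, ?_⟩
      · simpa [vert, hu, shift, localSolution, lowerLeft] using h3
      · simpa [vert, hu, shift, localSolution, upperLeft] using h4
      · simpa [vert, hu, shift, localSolution, lowerRight] using h2
      · simpa [vert, hu, shift, localSolution, upperRight] using h1)
    obtain ⟨e0, e1, e2⟩ := pd_rhs (φ := φ) (x := corner u) (by
      simpa [corner, hu, localSolution] using (H.analytic x hI.1).differentiableAt)
    rw [e0, e1, e2] at this
    simp [vert, hu, shift, localSolution, corner] at this
    simp [upperRight, lowerRight, lowerLeft, upperLeft]
    linarith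

theorem Admissible.not_cross_symmetry (H : Admissible φ I) (hlog : LogDerivEq φ I) :
    ¬ HasFivePointSymmetry (rhs φ) (rhsDom I) := by
  rintro ⟨Ω, G, hΩ, hΩc, hG, ⟨p, hp, hne⟩, ⟨u, hu, hdef⟩, hsym⟩
  obtain ⟨α, γ, hα, hlog⟩ := hlog
  apply hne
  have : (Pi.single 1 1 : Fin 5 → ℝ) = ![0, 1, 0, 0, 0] := by
    ext i; fin_cases i <;> simp
  rw [pd_eq_dirDeriv 1, this]
  suffices dirDeriv ![0, 1, 0, 0, 0] G p = 0 by rw [this]; ring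
  refine H.cross_symmetry hα hlog hΩ hΩc.isPreconnected hG ?_ ?_ p hp
  · simp only [solvesOn_rhs, mem_insert_iff, mem_singleton_iff, forall_eq_or_imp, forall_eq] at hu
    obtain ⟨d1, d2, d3, d4⟩ := hdef
    simp only [cross, shift, mem_ofPred_eq] at d1 d2 d3 d4
    norm_num at hu d1 d2 d3 d4
    obtain ⟨⟨i1, f1⟩, ⟨i2, f2⟩, ⟨i3, f3⟩, ⟨i4, f4⟩, i5, f5⟩ := hu
    refine ⟨(u 0 0, u 1 0, u 2 0, u (-1) 0, u 0 1, u 0 2, u 0 (-1)), ⟨i1, i2, i3, i4, i5⟩, ?_⟩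
    have e1 : u 0 1 - u 0 0 - φ (u (-1) 0) = u (-1) 1 := by linarith
    have e2 : u 1 0 - u 0 0 - φ (u 0 (-1)) = u 1 (-1) := by linarith
    simp only [crossUpperRight, crossLowerRight, crossLowerLeft, crossUpperLeft, ← f1, ← f2, ← f4,
      e1, e2]
    exact ⟨d4, d2, d1, d3⟩
  · rintro ⟨x, a, a₂, m, b, b₂, n⟩ ⟨hI, h1, h2, h3, h4⟩
    have hs : SolvesOn (rhs φ) (rhsDom I) {(0, 0), (1, 0), (-1, 0), (0, 1), (0, -1)}
        (localSolution φ x a a₂ m b b₂ n) := by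
      simp only [solvesOn_rhs, mem_insert_iff, mem_singleton_iff, forall_eq_or_imp, forall_eq]
      simp only [localSolution]
      norm_num
      exact ⟨hI.1, hI.2.1, ⟨hI.2.2.1, by ring⟩, hI.2.2.2.1, hI.2.2.2.2, by ring⟩
    have := hsym (localSolution φ x a a₂ m b b₂ n) hs (by
      refine ⟨?_, ?_, ?_, ?_⟩
      · simpa [cross, shift, localSolution, crossLowerLeft] using h3
      · simpa [cross, shift, localSolution, crossLowerRight] using h2
      · simpa [cross, shift, localSolution, crossUpperLeft] using h4
      · simpa [cross, shift, localSolution, crossUpperRight] using h1)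
    obtain ⟨e0, e1, e2⟩ := pd_rhs (φ := φ) (x := corner (localSolution φ x a a₂ m b b₂ n)) (by
      simpa [corner, localSolution] using (H.analytic x hI.1).differentiableAt)
    rw [e0, e1, e2] at this
    simpa [cross, shift, localSolution, corner, crossUpperRight, crossLowerRight, crossLowerLeft,
      crossUpperLeft] using this

/-! ### Integrability conditions and conservation laws -/

/-- Condition m = 2 alone forces L' = a(1 + φ') for L = log φ', and this integrates to (**). -/
theorem Admissible.logDerivEq (H : Admissible φ I)
    (h : IntegrabilityConditions (rhs φ) (rhsDom I)) : LogDerivEq φ I := by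
  obtain ⟨Ω, hΩ, -, ⟨Q, hQ, ⟨u, hu, hdef⟩, hlaw⟩, -, -⟩ := h
  have hL : AnalyticOnNhd ℝ (fun z => Real.log (deriv φ z)) I := fun z hz =>
    analyticAt_log_of_ne_zero (H.analytic_deriv z hz) (H.deriv_ne z hz)
  obtain ⟨a, ha⟩ : ∃ a, ∀ x ∈ I, deriv (fun z => Real.log (deriv φ z)) x =
      a * (1 + deriv φ x) := by
    simp only [rowQuads, solvesOn_rhs, mem_insert_iff, mem_singleton_iff, forall_eq_or_imp,
      forall_eq] at hu
    obtain ⟨d1, d2, d3, d4⟩ := hdef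
    simp only [row, shift, mem_ofPred_eq] at d3 d4
    norm_num at hu d3 d4
    refine H.deriv_eq_of_row_law hL (hΩ 1).1 (hΩ 1).2.isPreconnected hQ
      -- The fourth entry, the place of u₋₁₀, does not enter a row law; u₀₀ fills it because it lies
      -- in I.
      (w₀ := (u 0 0, u 1 0, u 2 0, u 0 0, u 0 1)) ⟨⟨hu.1.1, hu.2.1, hu.1.1⟩, ?_⟩ ?_
    · simp only [upperRight, lowerRight, ← hu.1.2, ← hu.2.2]
      exact ⟨d4, d3⟩
    · rintro ⟨x, a, a₂, m, b⟩ hx ha h1 h2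
      have hs : SolvesOn (rhs φ) (rhsDom I) rowQuads (localSolution φ x a a₂ m b 0 0) := by
        simp only [rowQuads, solvesOn_rhs, mem_insert_iff, mem_singleton_iff, forall_eq_or_imp,
          forall_eq]
        simp only [localSolution]
        norm_num
        exact ⟨hx, ha⟩
      have := hlaw (localSolution φ x a a₂ m b 0 0) hs (by
        refine ⟨?_, ?_, ?_, ?_⟩
        · simpa [ofCorner, rhsDom, corner, shift, localSolution] using hx
        · simpa [ofCorner, rhsDom, corner, shift, localSolution] using ha
        · simpa [row, shift, localSolution, lowerRight] using h2
        · simpa [row, shift, localSolution, upperRight] using h1)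
      obtain ⟨-, e1, e2⟩ := pd_rhs (φ := φ) (x := corner (localSolution φ x a a₂ m b 0 0)) (by
        simpa [corner, localSolution] using (H.analytic x hx).differentiableAt)
      obtain ⟨-, e1', e2'⟩ := pd_rhs (φ := φ)
        (x := corner (shift 1 0 (localSolution φ x a a₂ m b 0 0))) (by
        simpa [corner, shift, localSolution] using (H.analytic a ha).differentiableAt)
      simp only [ofCorner, p₂, e1, e2, e1', e2'] at this
      simp [row, shift, localSolution, corner] at this
      simp [upperRight, lowerRight]
      linarith
  obtain ⟨γ, hγ⟩ := eq_add_const_of_deriv_eq H.isOpen H.conn hL (g := fun z => a * (φ z + z))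
    (fun z hz => analyticAt_const.mul ((H.analytic z hz).add analyticAt_id)) (fun z hz => by
      rw [ha z hz, add_comm 1]
      exact ((((H.analytic z hz).differentiableAt.hasDerivAt.add
        (hasDerivAt_id' z)).const_mul a).deriv).symm)
  refine ⟨a, γ, ?_, hγ⟩
  -- If a = 0 then (log φ')' = φ''/φ' vanishes, against φ'' ≢ 0.
  rintro rfl
  obtain ⟨z, hz, hne⟩ := H.deriv2
  apply hne
  have e := ha z hz
  rw [((H.analytic_deriv z hz).differentiableAt.hasDerivAt.log (H.deriv_ne z hz)).deriv,
    zero_mul, div_eq_zero_iff] at e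
  exact e.resolve_right (H.deriv_ne z hz)

/-- Substituting u₁₁ and u₂₁ into the second differences is enough, so (**) plays no role. Were the
left side identically zero, φ(y) + y would be constant and φ' = -1. -/
theorem isConservationLaw_row_density (H : Admissible φ I) :
    IsNontrivialConservationLaw (rhs φ) (rhsDom I) rowQuads (density φ I)
      (row univ secondDiff) := by
  have hdef : ∀ u : Lattice, LawDefined (density φ I) (row univ secondDiff) u ↔
      u 0 0 ∈ I ∧ u 1 0 ∈ I := fun u => by simp [LawDefined, density, row, shift]
  have hsol : ∀ u : Lattice, SolvesOn (rhs φ) (rhsDom I) rowQuads u ↔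
      (u 0 0 ∈ I ∧ u 1 1 = u 1 0 + u 0 1 + φ (u 0 0)) ∧
        (u 1 0 ∈ I ∧ u 2 1 = u 2 0 + u 1 1 + φ (u 1 0)) := fun u => by
    simp [rowQuads, solvesOn_rhs]
  have hs : ∀ x ∈ I, ∀ y ∈ I, SolvesOn (rhs φ) (rhsDom I) rowQuads
      (localSolution φ x y 0 0 0 0 0) := fun x hx y hy => by
    rw [hsol]
    simp [localSolution, hx, hy]
  obtain ⟨z, hz, -⟩ := H.deriv2
  refine ⟨⟨⟨localSolution φ z z 0 0 0 0 0, hs z hz z hz, ?_⟩, ?_⟩, ?_, ?_⟩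
  · rw [hdef]; simp [localSolution, hz]
  · intro u hu _
    rw [hsol] at hu
    simp [density, row, shift, secondDiff, hu.1.2, hu.2.2]
    ring
  · by_contra! hno
    refine H.not_eventually_deriv_eq hz (-1) ?_
    have h1 : ∀ y ∈ I, φ y + y = φ z + z := fun y hy => by
      have := hno _ (hs z hz y hy) (by rw [hdef]; simp [localSolution, hz, hy])
      simp [density, shift, localSolution] at this
      linarith
    filter_upwards [H.isOpen.mem_nhds hz] with y hy
    have h2 : (fun t => φ t + t) =ᶠ[𝓝 y] fun _ => φ z + z := by
      filter_upwards [H.isOpen.mem_nhds hy] with t ht using h1 t ht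
    have h3 := ((H.analytic y hy).differentiableAt.hasDerivAt.add (hasDerivAt_id' y)).unique
      ((hasDerivAt_const y (φ z + z)).congr_of_eventuallyEq h2)
    linarith
  -- The bottom row is constant, so the density does not change, while the second difference is 1 on
  -- the row above and 0 on the bottom row.
  · refine ⟨fun i j => if j = 0 then z else if i = 0 then 1 else 0, ?_, ?_⟩
    · rw [hdef]; simp [hz]
    · simp [density, row, shift, secondDiff]
      intro h
      linarith

theorem isConservationLaw_col_density (H : Admissible φ I) :
    IsNontrivialConservationLaw (rhs φ) (rhsDom I) colQuads (col univ secondDiff)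
      (density φ I) := by
  have hdef : ∀ u : Lattice, LawDefined (col univ secondDiff) (density φ I) u ↔
      u 0 0 ∈ I ∧ u 0 1 ∈ I := fun u => by simp [LawDefined, density, col, shift]
  have hsol : ∀ u : Lattice, SolvesOn (rhs φ) (rhsDom I) colQuads u ↔
      (u 0 0 ∈ I ∧ u 1 1 = u 1 0 + u 0 1 + φ (u 0 0)) ∧
        (u 0 1 ∈ I ∧ u 1 2 = u 1 1 + u 0 2 + φ (u 0 1)) := fun u => by
    simp [colQuads, solvesOn_rhs]
  have hs : ∀ x ∈ I, ∀ y ∈ I, SolvesOn (rhs φ) (rhsDom I) colQuads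
      (localSolution φ x 0 0 0 y 0 0) := fun x hx y hy => by
    rw [hsol]
    simp [localSolution, hx, hy]
  have hlaw : ∀ u, SolvesOn (rhs φ) (rhsDom I) colQuads u →
      (col univ secondDiff).val (shift 1 0 u) - (col univ secondDiff).val u =
        (density φ I).val (shift 0 1 u) - (density φ I).val u := by
    intro u hu
    rw [hsol] at hu
    simp [density, col, shift, secondDiff, hu.1.2, hu.2.2]
    ring
  obtain ⟨z, hz, -⟩ := H.deriv2
  refine ⟨⟨⟨localSolution φ z 0 0 0 z 0 0, hs z hz z hz, ?_⟩, fun u hu _ => hlaw u hu⟩, ?_, ?_⟩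
  · rw [hdef]; simp [localSolution, hz]
  · by_contra! hno
    refine H.not_eventually_deriv_eq hz (-1) ?_
    have h1 : ∀ y ∈ I, φ y + y = φ z + z := fun y hy => by
      have := hno _ (hs z hz y hy) (by rw [hdef]; simp [localSolution, hz, hy])
      -- Nontriviality concerns the (T₁ - 1) side, here the second difference; the law turns it into
      -- the difference of densities.
      rw [hlaw _ (hs z hz y hy)] at this
      simp [density, shift, localSolution] at this
      linarith
    filter_upwards [H.isOpen.mem_nhds hz] with y hy
    have h2 : (fun t => φ t + t) =ᶠ[𝓝 y] fun _ => φ z + z := by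
      filter_upwards [H.isOpen.mem_nhds hy] with t ht using h1 t ht
    have h3 := ((H.analytic y hy).differentiableAt.hasDerivAt.add (hasDerivAt_id' y)).unique
      ((hasDerivAt_const y (φ z + z)).congr_of_eventuallyEq h2)
    linarith
  · refine ⟨fun i j => if i = 0 then z else if j = 0 then 1 else 0, ?_, ?_⟩
    · rw [hdef]; simp [hz]
    · simp [density, col, shift, secondDiff]
      intro h
      linarith

theorem analyticOnNhd_const_mul_secondDiff (a : ℝ) :
    AnalyticOnNhd ℝ (fun x => a * secondDiff x) univ := by
  intro x _
  have h : ∀ k : Fin 3, AnalyticAt ℝ (fun x : Fin 3 → ℝ => x k) x := fun k =>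
    (coord k).analyticAt x
  exact analyticAt_const.mul (((h 0).sub (analyticAt_const.mul (h 1))).add (h 2))

/-- Conditions 1 and 3 read 0 = 0, as log 1 = 0. By (**) conditions 2 and 4 are α times the density
laws, and γ cancels in the differences. -/
theorem Admissible.integrabilityConditionsOn (H : Admissible φ I) (h : LogDerivEq φ I) :
    IntegrabilityConditionsOn (rhs φ) (rhsDom I) (fun _ => univ) := by
  obtain ⟨α, γ, -, hlog⟩ := h
  obtain ⟨⟨⟨ur, hur, hurd⟩, hrow⟩, -, -⟩ := isConservationLaw_row_density H
  obtain ⟨⟨⟨uc, huc, hucd⟩, hcol⟩, -, -⟩ := isConservationLaw_col_density H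
  have hpd : ∀ u : Lattice, u 0 0 ∈ I → pd 0 (rhs φ) (corner u) = 1 ∧
      pd 1 (rhs φ) (corner u) = deriv φ (u 0 0) ∧ pd 2 (rhs φ) (corner u) = 1 := fun u hu =>
    pd_rhs (x := corner u) (H.analytic (u 0 0) hu).differentiableAt
  refine ⟨⟨fun _ => 0, analyticOnNhd_const, ⟨ur, hur, ?_⟩, ?_⟩,
    ⟨fun x => α * secondDiff x, analyticOnNhd_const_mul_secondDiff α, ⟨ur, hur, ?_⟩, ?_⟩,
    ⟨fun _ => 0, analyticOnNhd_const, ⟨uc, huc, ?_⟩, ?_⟩,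
    ⟨fun x => α * secondDiff x, analyticOnNhd_const_mul_secondDiff α, ⟨uc, huc, ?_⟩, ?_⟩⟩
  · exact ⟨hurd.1, hurd.2.1, trivial, trivial⟩
  · rintro u - ⟨h1, h2, -, -⟩
    simp [ofCorner, row, p₁, (hpd u h1).1, (hpd (shift 1 0 u) h2).1]
  · exact ⟨hurd.1, hurd.2.1, trivial, trivial⟩
  · rintro u hu ⟨h1, h2, -, -⟩
    have := hrow u hu ⟨h1, h2, trivial, trivial⟩
    obtain ⟨-, e1, e2⟩ := hpd u h1
    obtain ⟨-, e1', e2'⟩ := hpd (shift 1 0 u) h2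
    simp only [ofCorner, row, p₂, e1, e2, e1', e2', div_one]
    rw [hlog (u 0 0) h1, hlog (shift 1 0 u 0 0) h2]
    simp only [density, row] at this
    linear_combination α * this
  · exact ⟨trivial, trivial, hucd.2.2.1, hucd.2.2.2⟩
  · rintro u - ⟨-, -, h1, h2⟩
    simp [ofCorner, col, q₃, (hpd u h1).2.2, (hpd (shift 0 1 u) h2).2.2]
  · exact ⟨trivial, trivial, hucd.2.2.1, hucd.2.2.2⟩
  · rintro u hu ⟨-, -, h1, h2⟩
    have := hcol u hu ⟨trivial, trivial, h1, h2⟩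
    obtain ⟨e0, e1, -⟩ := hpd u h1
    obtain ⟨e0', e1', -⟩ := hpd (shift 0 1 u) h2
    simp only [ofCorner, col, q₄, e0, e1, e0', e1', div_one]
    rw [hlog (u 0 0) h1, hlog (shift 0 1 u 0 0) h2]
    simp only [density, col] at this
    linear_combination α * this

end QuadEq

theorem theorem8 (I : Set ℝ) (hI : IsOpen I) (hIc : IsPreconnected I) (φ : ℝ → ℝ)
    (hφ : AnalyticOnNhd ℝ φ I) (hφ' : ∀ z ∈ I, deriv φ z ≠ 0)
    (hφ'' : ∃ z ∈ I, deriv (deriv φ) z ≠ 0) :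
    (QuadEq.IntegrabilityConditions (QuadEq.rhs φ) (QuadEq.rhsDom I) ↔ QuadEq.LogDerivEq φ I) ∧
    (QuadEq.LogDerivEq φ I →
      QuadEq.IntegrabilityConditionsOn (QuadEq.rhs φ) (QuadEq.rhsDom I) (fun _ => Set.univ) ∧
      QuadEq.IsNontrivialConservationLaw (QuadEq.rhs φ) (QuadEq.rhsDom I) QuadEq.rowQuads
        (QuadEq.density φ I) (QuadEq.row Set.univ QuadEq.secondDiff) ∧
      QuadEq.IsNontrivialConservationLaw (QuadEq.rhs φ) (QuadEq.rhsDom I) QuadEq.colQuads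
        (QuadEq.col Set.univ QuadEq.secondDiff) (QuadEq.density φ I) ∧
      ¬ QuadEq.HasFivePointSymmetry (QuadEq.rhs φ) (QuadEq.rhsDom I) ∧
      ¬ QuadEq.HasHorizontalSymmetry (QuadEq.rhs φ) (QuadEq.rhsDom I) ∧
      ¬ QuadEq.HasVerticalSymmetry (QuadEq.rhs φ) (QuadEq.rhsDom I)) := by
  have H : QuadEq.Admissible φ I := ⟨hI, hIc, hφ, hφ', hφ''⟩
  refine ⟨⟨H.logDerivEq, fun h => ⟨fun _ => Set.univ, fun _ => ⟨isOpen_univ, isConnected_univ⟩,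
    H.integrabilityConditionsOn h⟩⟩, fun h => ⟨H.integrabilityConditionsOn h,
    QuadEq.isConservationLaw_row_density H, QuadEq.isConservationLaw_col_density H,
    H.not_cross_symmetry h, H.not_row_symmetry h, H.not_col_symmetry h⟩⟩
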